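/- Let $V$ be a finite vertex set, $n=|V|$. A cluster graph is a graph in which every connected component is a clique. For a graph $G_i=(V,E_i)$ and a set $M_i\subseteq\binom V2$ of edits let $G_i'=(V,E_i\oplus M_i)$, where $\oplus$ is the symmetric difference. Given layers $G_1,\dots,G_\ell$ on $V$ and $k,d\in\mathbb N$, both of the following problems ask for edit sets $M_1,\dots,M_\ell$ with $|M_i|\le k$ such that every $G_i'$ is a cluster graph and such that, in addition, - (Temporal Cluster Editing, TCE) there are sets $D_1,\dots,D_{\ell-1}\subseteq V$ of size at most $d$ with $G_i'[V\setminus D_i]=G_{i+1}'[V\setminus D_i]$ for all $1\le i\le \ell-1$; - (Multi-Layer Cluster Editing, MLCE) there is one set $D\subseteq V$ of size at most $d$ with $G_i'[V\setminus D]=G_j'[V\setminus D]$ for all $i,j$. **Proposition.** If $k=0$ and $\ell=2$, then both TCE and MLCE can be solved in $O(n^2\log n)$ time. That is, for each of the two problems there are one fixed program of a unit-cost word RAM (with words of $O(\log(n+d))$ bits, the layers being given by their adjacency matrices) and a function $T\colon\mathbb N\to\mathbb N$ with $T(n)=O(n^2\log n)$ such that on every input $(G_1,G_2,d)$ with $n$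 vertices the program halts within $T(n)$ steps and answers correctly whether $(G_1,G_2)$ with $k=0$ and $d$ is a yes-instance. Moreover, let $H$ be the complete bipartite graph whose two sides are the maximal cliques of $G_1$ and the maximal cliques of $G_2$, the edge between $X$ and $Y$ having weight $|X\cap Y|$. Then, for each of TCE and MLCE, $(G_1,G_2)$ with $k=0$ and $d$ is a yes-instance if and only if $G_1$ and $G_2$ are both cluster graphs and $H$ has a matching of weight at least $n-d$. -/

import Mathlib

open Filter Asymptotics

/-! ## Cluster graphs, clusterings, and the two problems -/

/-- A cluster graph: every connected component is a clique. -/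
def IsClusterGraph {V : Type*} (G : SimpleGraph V) : Prop :=
  ∀ c : G.ConnectedComponent, G.IsClique c.supp

/-- The graph `(V, E ⊕ M)` obtained from `G = (V, E)` by applying the edits in `M`, where `⊕` is the
symmetric difference. -/
def editGraph {V : Type*} (G : SimpleGraph V) (M : Finset (Sym2 V)) : SimpleGraph V :=
  SimpleGraph.fromEdgeSet (symmDiff G.edgeSet (M : Set (Sym2 V)))

/-- `M` is a set of edits (unordered pairs of distinct vertices) that turns `G` into a cluster
graph. -/
def IsClusterEditingSet {V : Type*} (G : SimpleGraph V) (M : Finset (Sym2 V)) : Prop :=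
  (∀ e ∈ M, ¬ e.IsDiag) ∧ IsClusterGraph (editGraph G M)

/-- `M = (M i)` is a clustering of the layers `G i`: each `M i` is a cluster editing set for `G i`. -/
def IsClustering {V : Type*} {l : ℕ} (G : Fin l → SimpleGraph V)
    (M : Fin l → Finset (Sym2 V)) : Prop :=
  ∀ i, IsClusterEditingSet (G i) (M i)

/-- Every layer is edited at most `k` times. -/
def IsBounded {V : Type*} {l : ℕ} (k : ℕ) (M : Fin l → Finset (Sym2 V)) : Prop :=
  ∀ i, (M i).card ≤ k

/-- Temporal `d`-consistency: for each pair of consecutive layers there is a set of at most `d`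
marked vertices outside of which the two edited layers induce the same graph. -/
def IsTemporallyConsistent {V : Type*} {l : ℕ} (d : ℕ) (G : Fin l → SimpleGraph V)
    (M : Fin l → Finset (Sym2 V)) : Prop :=
  ∃ D : Fin (l - 1) → Finset V, ∀ i : Fin (l - 1), (D i).card ≤ d ∧
    (editGraph (G ⟨i, by omega⟩) (M ⟨i, by omega⟩)).induce ((D i : Set V)ᶜ) =
      (editGraph (G ⟨i + 1, by omega⟩) (M ⟨i + 1, by omega⟩)).induce ((D i : Set V)ᶜ)

/-- Total `d`-consistency: there is one set of at most `d` marked vertices outside of which all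
edited layers induce the same graph. -/
def IsTotallyConsistent {V : Type*} {l : ℕ} (d : ℕ) (G : Fin l → SimpleGraph V)
    (M : Fin l → Finset (Sym2 V)) : Prop :=
  ∃ D : Finset V, D.card ≤ d ∧ ∀ i j : Fin l,
    (editGraph (G i) (M i)).induce ((D : Set V)ᶜ) = (editGraph (G j) (M j)).induce ((D : Set V)ᶜ)

/-- Temporal Cluster Editing: `(G, k, d)` is a yes-instance. -/
def TCE {V : Type*} {l : ℕ} (G : Fin l → SimpleGraph V) (k d : ℕ) : Prop :=
  ∃ M : Fin l → Finset (Sym2 V), IsClustering G M ∧ IsBounded k M ∧ IsTemporallyConsistent d G M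

/-- Multi-Layer Cluster Editing: `(G, k, d)` is a yes-instance. -/
def MLCE {V : Type*} {l : ℕ} (G : Fin l → SimpleGraph V) (k d : ℕ) : Prop :=
  ∃ M : Fin l → Finset (Sym2 V), IsClustering G M ∧ IsBounded k M ∧ IsTotallyConsistent d G M

/-! ## The weighted bipartite cluster-intersection graph -/

/-- The maximal cliques of a graph (for a cluster graph on a nonempty vertex set, these are its
clusters). -/
abbrev MaxClique {V : Type*} (G : SimpleGraph V) : Type _ :=
  {X : Set V // Maximal G.IsClique X}

/-- The intersection graph `H` of `G₁` and `G₂`: the complete bipartite graph between the maximal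
cliques of `G₁` and the maximal cliques of `G₂`. -/
abbrev interGraph {V : Type*} (G₁ G₂ : SimpleGraph V) :
    SimpleGraph (MaxClique G₁ ⊕ MaxClique G₂) :=
  completeBipartiteGraph (MaxClique G₁) (MaxClique G₂)

/-- The vertex set of `G₁`, `G₂` that a vertex of the intersection graph stands for. -/
def cliqueOf {V : Type*} {G₁ G₂ : SimpleGraph V} : MaxClique G₁ ⊕ MaxClique G₂ → Set V :=
  Sum.elim Subtype.val Subtype.val

/-- The weight of the edge between `X` and `Y` is `|X ∩ Y|`. -/
noncomputable def interWeight {V : Type*} {G₁ G₂ : SimpleGraph V} :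
    Sym2 (MaxClique G₁ ⊕ MaxClique G₂) → ℕ :=
  Sym2.lift ⟨fun p q => (cliqueOf p ∩ cliqueOf q).ncard, fun _ _ =>
    congrArg Set.ncard (Set.inter_comm _ _)⟩

/-- The weight of a matching (or of any subgraph) of the intersection graph: the sum of the weights
of its edges. -/
noncomputable def matchingWeight {V : Type*} {G₁ G₂ : SimpleGraph V}
    (M : (interGraph G₁ G₂).Subgraph) : ℕ :=
  ∑ᶠ e ∈ M.edgeSet, interWeight e

/-! ## A random access machine with a step count

The machine has registers, addressed by literal register names in the program, and one random
access memory, addressed by computed addresses. All of them hold natural numbers. Programs are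
structured (sequences, branches, loops); every operator occurring in an evaluated expression, every
assignment and every test costs one time unit. The semantics carries a bound `B`: a run is only
legal if every number read, computed or used as an address is at most `B`, so that with `B`
polynomial in the input numbers this is a word RAM with words of logarithmic length. -/

/-- Expressions: literals, register contents, memory contents at a computed address, arithmetic
(with truncated subtraction) and comparisons (with values `0` and `1`). -/
inductive RamExpr : Type
  | const (c : ℕ)
  | reg (r : ℕ)
  | load (a : RamExpr)
  | add (e f : RamExpr)
  | sub (e f : RamExpr)
  | mul (e f : RamExpr)
  | lt (e f : RamExpr)
  | eq (e f : RamExpr)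

/-- A state of the machine: the contents of the registers and of the memory. -/
@[ext] structure RamState : Type where
  reg : ℕ → ℕ
  mem : ℕ → ℕ

/-- The value of an expression. -/
def RamExpr.eval (s : RamState) : RamExpr → ℕ
  | .const c => c
  | .reg r => s.reg r
  | .load a => s.mem (a.eval s)
  | .add e f => e.eval s + f.eval s
  | .sub e f => e.eval s - f.eval s
  | .mul e f => e.eval s * f.eval s
  | .lt e f => if e.eval s < f.eval s then 1 else 0
  | .eq e f => if e.eval s = f.eval s then 1 else 0

/-- The evaluation time of an expression: the number of its nodes. -/
def RamExpr.cost : RamExpr → ℕ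
  | .const _ => 1
  | .reg _ => 1
  | .load a => a.cost + 1
  | .add e f => e.cost + f.cost + 1
  | .sub e f => e.cost + f.cost + 1
  | .mul e f => e.cost + f.cost + 1
  | .lt e f => e.cost + f.cost + 1
  | .eq e f => e.cost + f.cost + 1

/-- All numbers that occur in the evaluation of an expression, addresses included, are at most
`B`. -/
def RamExpr.Fits (B : ℕ) (s : RamState) : RamExpr → Prop
  | .const c => c ≤ B
  | .reg r => s.reg r ≤ B
  | .load a => a.Fits B s ∧ s.mem (a.eval s) ≤ B
  | .add e f => e.Fits B s ∧ f.Fits B s ∧ e.eval s + f.eval s ≤ B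
  | .sub e f => e.Fits B s ∧ f.Fits B s
  | .mul e f => e.Fits B s ∧ f.Fits B s ∧ e.eval s * f.eval s ≤ B
  | .lt e f => e.Fits B s ∧ f.Fits B s ∧ 1 ≤ B
  | .eq e f => e.Fits B s ∧ f.Fits B s ∧ 1 ≤ B

/-- Programs. The test of a branch or loop succeeds if the value of the expression is nonzero. -/
inductive RamProg : Type
  | skip
  | assign (r : ℕ) (e : RamExpr)
  | store (a e : RamExpr)
  | seq (p q : RamProg)
  | ite (e : RamExpr) (p q : RamProg)
  | loop (e : RamExpr) (p : RamProg)

/-- `RamExec B p s t s'`: started in state `s`, the program `p` halts after exactly `t` time units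
in state `s'`, and no number exceeding `B` occurs during the run. -/
inductive RamExec (B : ℕ) : RamProg → RamState → ℕ → RamState → Prop
  | skip (s : RamState) : RamExec B .skip s 1 s
  | assign (s : RamState) (r : ℕ) (e : RamExpr) (he : e.Fits B s) :
      RamExec B (.assign r e) s (e.cost + 1) ⟨Function.update s.reg r (e.eval s), s.mem⟩
  | store (s : RamState) (a e : RamExpr) (ha : a.Fits B s) (he : e.Fits B s) :
      RamExec B (.store a e) s (a.cost + e.cost + 1)
        ⟨s.reg, Function.update s.mem (a.eval s) (e.eval s)⟩
  | seq {p q : RamProg} {s s' s'' : RamState} {t t' : ℕ}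
      (hp : RamExec B p s t s') (hq : RamExec B q s' t' s'') :
      RamExec B (.seq p q) s (t + t') s''
  | ite_true {e : RamExpr} {p q : RamProg} {s s' : RamState} {t : ℕ}
      (he : e.Fits B s) (h : e.eval s ≠ 0) (hp : RamExec B p s t s') :
      RamExec B (.ite e p q) s (e.cost + 1 + t) s'
  | ite_false {e : RamExpr} {p q : RamProg} {s s' : RamState} {t : ℕ}
      (he : e.Fits B s) (h : e.eval s = 0) (hq : RamExec B q s t s') :
      RamExec B (.ite e p q) s (e.cost + 1 + t) s'
  | loop_true {e : RamExpr} {p : RamProg} {s s' s'' : RamState} {t t' : ℕ}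
      (he : e.Fits B s) (h : e.eval s ≠ 0) (hp : RamExec B p s t s')
      (hl : RamExec B (.loop e p) s' t' s'') :
      RamExec B (.loop e p) s (e.cost + 1 + t + t') s''
  | loop_false {e : RamExpr} {p : RamProg} {s : RamState}
      (he : e.Fits B s) (h : e.eval s = 0) :
      RamExec B (.loop e p) s (e.cost + 1) s

/-- The initial state for an input `(G, d)` with two layers on the vertex set `{0, …, n - 1}`:
register `0` holds `n`, register `1` holds `d`, and the memory holds the two adjacency matrices, one
after the other and each row by row. All other cells are `0`. -/
noncomputable def ramInput {n : ℕ} (G : Fin 2 → SimpleGraph (Fin n)) (d : ℕ) : RamState where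
  reg r := if r = 0 then n else if r = 1 then d else 0
  mem a := open Classical in
    if ∃ (i : Fin 2) (u v : Fin n),
        a = (i : ℕ) * (n * n) + (u : ℕ) * n + (v : ℕ) ∧ (G i).Adj u v
    then 1 else 0

/-- The decision problem `L` on inputs `(G, d)`, where `G` has two layers on `n` vertices, can be
solved in `O(f n)` time: one fixed program halts on every input with `n` vertices within `T n` time
units, where `T` is `O(f)` and does not depend on the rest of the input, with the answer `1` (yes) or
`0` (no) in register `0`, and only uses numbers bounded by a fixed power of `n + d + 2`. -/
def SolvableInTime (L : ∀ {n : ℕ}, (Fin 2 → SimpleGraph (Fin n)) → ℕ → Prop) (f : ℕ → ℝ) : Prop :=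
  ∃ (p : RamProg) (c : ℕ) (T : ℕ → ℕ), (fun n => (T n : ℝ)) =O[atTop] f ∧
    ∀ (n : ℕ) (G : Fin 2 → SimpleGraph (Fin n)) (d : ℕ), ∃ (t : ℕ) (s : RamState),
      RamExec ((n + d + 2) ^ c) p (ramInput G d) t s ∧ t ≤ T n ∧
      (L G d → s.reg 0 = 1) ∧ (¬ L G d → s.reg 0 = 0)

/-! ## Program logic for the random access machine -/

/-! With `k = 0` all edit sets are empty, and with two layers there is only one set of marked
vertices. So both problems ask whether the layers are cluster graphs that agree on some set `K` of
at least `n - d` vertices (`tce_iff`, `mlce_iff`). If they agree on `K`, the pairs of clusters that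
share a vertex of `K` form a matching of `H` of weight at least `|K|`. Conversely, the union of the
intersections along a matching is such a `K`, of exactly the matching's weight
(`agreeUpTo_iff_exists_isMatching`).

The program runs the Hungarian method with potentials in `ℕ`. A vertex `z` of `V` stands for the
edge of `H` between its clusters `a z` and `b z`. All other edges have weight zero and are covered
by any potentials, so only `n` edges have to be scanned. The invariant `PrimalDual` says that `u`,
`v` cover the weights, matched edges are tight, right vertices of positive potential are matched,
and processed left vertices are matched or have potential zero. The parameter `cur = n` means that
no right vertex is exempt. By weak duality (`PrimalDual.card_le`) and complementary slackness
(`PrimalDual.exists_le_card`), the final sum of the potentials is the largest possible `|K|`; the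
program only compares this sum with the budget.

Initially `u` is the cluster size and `v` is zero. From an unmatched left vertex `r` of positive
potential, a breadth-first search follows tight edges. It succeeds at a right vertex that is
unmatched or whose partner has potential zero and may be released. If it fails, the reached left
vertices lose one unit, the reached right vertices gain one (`PrimalDual.change`), and the search
starts afresh. Unit steps are affordable: the sum of `u` is at most `n` initially, never grows, and
drops with each failure, while every other round advances `r`. Hence there are at most `2n` rounds
of `O(n)` steps, and `O(n^2)` steps in all, including the preparation.

Cluster graphs are recognised by labelling each vertex with the least vertex equal or adjacent to
it: adjacency-or-equality is an equivalence relation exactly if it coincides with having equal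
labels (`IsEquivBelow.of_iff`, `IsEquivBelow.iff_least`). -/

instance : Add RamExpr := ⟨.add⟩
instance : Sub RamExpr := ⟨.sub⟩
instance : Mul RamExpr := ⟨.mul⟩

namespace RamState

/-- All registers and all memory cells are at most `W`. -/
def Bdd (W : ℕ) (s : RamState) : Prop :=
  (∀ r, s.reg r ≤ W) ∧ ∀ p, s.mem p ≤ W

/-- Write a register. -/
def set (s : RamState) (r v : ℕ) : RamState :=
  ⟨Function.update s.reg r v, s.mem⟩

/-- Sixteen arrays are interleaved in the memory above the address in register `2`; this is
the `k`-th one. -/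
def col (s : RamState) (k i : ℕ) : ℕ :=
  s.mem (s.reg 2 + (16 * i + k))

/-- Write entry `i` of the `k`-th array. -/
def setCol (s : RamState) (k i v : ℕ) : RamState :=
  ⟨s.reg, Function.update s.mem (s.reg 2 + (16 * i + k)) v⟩

@[simp] theorem set_reg_self (s : RamState) (r v : ℕ) : (s.set r v).reg r = v := by
  simp [set]

@[simp] theorem set_reg_of_ne (s : RamState) {r r' : ℕ} (v : ℕ) (h : r' ≠ r) :
    (s.set r v).reg r' = s.reg r' := by
  simp [set, h]

@[simp] theorem set_mem (s : RamState) (r v : ℕ) : (s.set r v).mem = s.mem := rfl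

@[simp] theorem setCol_reg (s : RamState) (k i v : ℕ) : (s.setCol k i v).reg = s.reg := rfl

@[simp] theorem col_set (s : RamState) {r : ℕ} (v : ℕ) (h : 2 ≠ r) (k : ℕ) :
    (s.set r v).col k = s.col k := by
  funext i; simp [col, h]

@[simp] theorem col_setCol_self (s : RamState) (k i v : ℕ) :
    (s.setCol k i v).col k = Function.update (s.col k) i v := by
  funext j
  by_cases h : j = i
  · subst h; simp [col, setCol]
  · simp [col, setCol, h]

-- Residues modulo 16 keep the arrays apart, so a write leaves each other array unchanged as a whole
-- function, without any bound on the indices.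
@[simp] theorem col_setCol_of_ne (s : RamState) {k k' : ℕ} (i v : ℕ) (h : k' ≠ k) (hk : k < 16)
    (hk' : k' < 16) : (s.setCol k i v).col k' = s.col k' := by
  funext j
  have : s.reg 2 + (16 * j + k') ≠ s.reg 2 + (16 * i + k) := by omega
  simp only [col, setCol]
  rw [Function.update_of_ne this]

/-- The adjacency matrices lie below the base address in register `2`, so writes to the arrays never
destroy the input. -/
theorem setCol_mem_of_lt (s : RamState) (k i v : ℕ) {p : ℕ} (h : p < s.reg 2) :
    (s.setCol k i v).mem p = s.mem p := by
  have : p ≠ s.reg 2 + (16 * i + k) := by omega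
  simp only [setCol]
  rw [Function.update_of_ne this]

theorem Bdd.col {W : ℕ} {s : RamState} (h : s.Bdd W) (k i : ℕ) : s.col k i ≤ W := h.2 _

theorem Bdd.set {W : ℕ} {s : RamState} (h : s.Bdd W) {r v : ℕ} (hv : v ≤ W) :
    (s.set r v).Bdd W := by
  refine ⟨fun r' => ?_, h.2⟩
  by_cases e : r' = r
  · subst e; simpa using hv
  · simpa [e] using h.1 r'

theorem Bdd.update_mem {W : ℕ} {s : RamState} (h : s.Bdd W) {p v : ℕ} (hv : v ≤ W) :
    Bdd W ⟨s.reg, Function.update s.mem p v⟩ := by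
  refine ⟨h.1, fun q => ?_⟩
  by_cases e : q = p
  · subst e; simpa using hv
  · simpa [e] using h.2 q

end RamState

/-- The truth value of `p` as a number. -/
noncomputable def flag (p : Prop) : ℕ := by
  classical exact if p then 1 else 0

theorem flag_eq_ite (p : Prop) [Decidable p] : flag p = if p then 1 else 0 := by
  unfold flag; congr

@[simp] theorem flag_eq_zero {p : Prop} : flag p = 0 ↔ ¬ p := by
  classical simp [flag_eq_ite]

theorem flag_of_true {p : Prop} (h : p) : flag p = 1 := by
  classical simp [flag_eq_ite, h]

theorem flag_le_one (p : Prop) : flag p ≤ 1 := by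
  classical rw [flag_eq_ite]; split_ifs <;> simp

namespace RamExpr

/-- The `k`-th array at a computed index. -/
def arr (k : ℕ) (e : RamExpr) : RamExpr :=
  .load (.add (.reg 2) (.add (.mul (.const 16) e) (.const k)))

section eval
variable (s : RamState) (e f : RamExpr) (k c r : ℕ)

@[simp] theorem eval_arr : (arr k e).eval s = s.col k (e.eval s) := rfl
@[simp] theorem eval_const : (const c).eval s = c := rfl
@[simp] theorem eval_reg : (reg r).eval s = s.reg r := rfl
@[simp] theorem eval_load : (load e).eval s = s.mem (e.eval s) := rfl
@[simp] theorem eval_add : (e + f).eval s = e.eval s + f.eval s := rfl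
@[simp] theorem eval_sub : (e - f).eval s = e.eval s - f.eval s := rfl
@[simp] theorem eval_mul : (e * f).eval s = e.eval s * f.eval s := rfl
@[simp] theorem eval_lt : (lt e f).eval s = flag (e.eval s < f.eval s) := by
  rw [flag_eq_ite]; rfl
@[simp] theorem eval_eq : (eq e f).eval s = flag (e.eval s = f.eval s) := by
  rw [flag_eq_ite]; rfl

end eval

/-- All literals are at most `16`. -/
def smallConsts : RamExpr → Bool
  | .const c => c ≤ 16
  | .reg _ => true
  | .load a => a.smallConsts
  | .add e f => e.smallConsts && f.smallConsts
  | .sub e f => e.smallConsts && f.smallConsts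
  | .mul e f => e.smallConsts && f.smallConsts
  | .lt e f => e.smallConsts && f.smallConsts
  | .eq e f => e.smallConsts && f.smallConsts

/-- A short expression with small literals. -/
def Small (e : RamExpr) : Prop :=
  e.smallConsts = true ∧ e.cost ≤ 64

instance (e : RamExpr) : Decidable e.Small := inferInstanceAs (Decidable (_ ∧ _))

theorem Fits.mono {B B' : ℕ} (h : B ≤ B') {s : RamState} :
    ∀ {e : RamExpr}, e.Fits B s → e.Fits B' s
  | .const _, he => le_trans he h
  | .reg _, he => le_trans he h
  | .load _, he => ⟨he.1.mono h, he.2.trans h⟩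
  | .add _ _, he => ⟨he.1.mono h, he.2.1.mono h, he.2.2.trans h⟩
  | .sub _ _, he => ⟨he.1.mono h, he.2.mono h⟩
  | .mul _ _, he => ⟨he.1.mono h, he.2.1.mono h, he.2.2.trans h⟩
  | .lt _ _, he => ⟨he.1.mono h, he.2.1.mono h, he.2.2.trans h⟩
  | .eq _ _, he => ⟨he.1.mono h, he.2.1.mono h, he.2.2.trans h⟩

/-- Sums and products of values at most `W ^ i` and `W ^ j` are at most `W ^ (i + j + 1)`, so the
cost of an expression is a valid exponent. Literals are at most `16 ≤ W`, and memory contents are at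
most `W` by assumption. -/
theorem fits_pow_cost {W : ℕ} (hW : 16 ≤ W) {s : RamState} (hs : s.Bdd W) (e : RamExpr)
    (he : e.smallConsts = true) : e.Fits (W ^ e.cost) s ∧ e.eval s ≤ W ^ e.cost := by
  have one (k : ℕ) : 1 ≤ W ^ k := Nat.one_le_pow _ _ (by omega)
  have up {i j : ℕ} (h : i ≤ j) : W ^ i ≤ W ^ j := Nat.pow_le_pow_right (by omega) h
  have self (k : ℕ) (hk : k ≠ 0) : W ≤ W ^ k := Nat.le_self_pow hk W
  induction e with
  | const c =>
    have : c ≤ W := le_trans (by simpa [smallConsts] using he) hW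
    simpa [Fits, eval, cost] using this
  | reg r => simpa [Fits, eval, cost] using hs.1 r
  | load a ih =>
    obtain ⟨h1, -⟩ := ih he
    have := (hs.2 (a.eval s)).trans (self (a.cost + 1) (by omega))
    exact ⟨⟨h1.mono (up (Nat.le_succ _)), this⟩, this⟩
  | add e f ihe ihf =>
    simp only [smallConsts, Bool.and_eq_true] at he
    obtain ⟨h1, h1'⟩ := ihe he.1
    obtain ⟨h2, h2'⟩ := ihf he.2
    have hle : e.eval s + f.eval s ≤ W ^ (e.cost + f.cost + 1) := by
      have h3 : W ^ e.cost ≤ W ^ (e.cost + f.cost) := up (by omega)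
      have h4 : W ^ f.cost ≤ W ^ (e.cost + f.cost) := up (by omega)
      rw [pow_succ]
      nlinarith
    exact ⟨⟨h1.mono (up (by simp only [cost]; omega)), h2.mono (up (by simp only [cost]; omega)), hle⟩, hle⟩
  | mul e f ihe ihf =>
    simp only [smallConsts, Bool.and_eq_true] at he
    obtain ⟨h1, h1'⟩ := ihe he.1
    obtain ⟨h2, h2'⟩ := ihf he.2
    have hle : e.eval s * f.eval s ≤ W ^ (e.cost + f.cost + 1) :=
      calc e.eval s * f.eval s ≤ W ^ e.cost * W ^ f.cost := Nat.mul_le_mul h1' h2'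
        _ = W ^ (e.cost + f.cost) := (pow_add _ _ _).symm
        _ ≤ _ := up (by omega)
    exact ⟨⟨h1.mono (up (by simp only [cost]; omega)), h2.mono (up (by simp only [cost]; omega)), hle⟩, hle⟩
  | sub e f ihe ihf =>
    simp only [smallConsts, Bool.and_eq_true] at he
    obtain ⟨h1, h1'⟩ := ihe he.1
    obtain ⟨h2, -⟩ := ihf he.2
    exact ⟨⟨h1.mono (up (by simp only [cost]; omega)), h2.mono (up (by simp only [cost]; omega))⟩,
      (Nat.sub_le _ _).trans (h1'.trans (up (by simp only [cost]; omega)))⟩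
  | lt e f ihe ihf =>
    simp only [smallConsts, Bool.and_eq_true] at he
    obtain ⟨h1, -⟩ := ihe he.1
    obtain ⟨h2, -⟩ := ihf he.2
    refine ⟨⟨h1.mono (up (by simp only [cost]; omega)), h2.mono (up (by simp only [cost]; omega)), one _⟩, ?_⟩
    have := one (e.cost + f.cost + 1)
    simp only [eval, cost]; split_ifs <;> omega
  | eq e f ihe ihf =>
    simp only [smallConsts, Bool.and_eq_true] at he
    obtain ⟨h1, -⟩ := ihe he.1
    obtain ⟨h2, -⟩ := ihf he.2
    refine ⟨⟨h1.mono (up (by simp only [cost]; omega)), h2.mono (up (by simp only [cost]; omega)), one _⟩, ?_⟩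
    have := one (e.cost + f.cost + 1)
    simp only [eval, cost]; split_ifs <;> omega

theorem Small.fits {W : ℕ} (hW : 16 ≤ W) {s : RamState} (hs : s.Bdd W) {e : RamExpr}
    (he : e.Small) : e.Fits (W ^ 64) s :=
  (fits_pow_cost hW hs e he.1).1.mono (Nat.pow_le_pow_right (by omega) he.2)

end RamExpr

/-! ### Weakest preconditions and Hoare rules with time bounds -/

namespace RamProg

/-- Write the `k`-th array at a computed index. -/
def setArr (k : ℕ) (i e : RamExpr) : RamProg :=
  .store (.add (.reg 2) (.add (.mul (.const 16) i) (.const k))) e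

/-- Sequential composition of a list of programs. -/
def block : List RamProg → RamProg
  | [] => .skip
  | [p] => p
  | p :: q :: l => .seq p (block (q :: l))

/-- All expressions in the program are small. -/
def Small : RamProg → Prop
  | .skip => True
  | .assign _ e => e.Small
  | .store a e => a.Small ∧ e.Small
  | .seq p q => p.Small ∧ q.Small
  | .ite e p q => e.Small ∧ p.Small ∧ q.Small
  | .loop e p => e.Small ∧ p.Small

instance decidableSmall : (p : RamProg) → Decidable p.Small
  | .skip => .isTrue trivial
  | .assign _ e => inferInstanceAs (Decidable e.Small)
  | .store a e => inferInstanceAs (Decidable (a.Small ∧ e.Small))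
  | .seq p q => @instDecidableAnd _ _ (decidableSmall p) (decidableSmall q)
  | .ite e p q => @instDecidableAnd e.Small _ _
      (@instDecidableAnd _ _ (decidableSmall p) (decidableSmall q))
  | .loop e p => @instDecidableAnd e.Small _ _ (decidableSmall p)

/-- An upper bound for the running time of a loop-free program. -/
def time : RamProg → ℕ
  | .skip => 1
  | .assign _ e => e.cost + 1
  | .store a e => a.cost + e.cost + 1
  | .seq p q => p.time + q.time
  | .ite e p q => e.cost + 1 + max p.time q.time
  -- A junk value: the weakest precondition of a loop is `False`, so it never serves as the bound
  -- for a loop that runs.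
  | .loop _ _ => 0

/-- Weakest precondition of a loop-free program that only writes numbers up to `W`. -/
def wp (W : ℕ) : RamProg → (RamState → Prop) → RamState → Prop
  | .skip, Q, s => Q s
  | .assign r e, Q, s => e.eval s ≤ W ∧ Q (s.set r (e.eval s))
  | .store a e, Q, s =>
    e.eval s ≤ W ∧ Q ⟨s.reg, Function.update s.mem (a.eval s) (e.eval s)⟩
  | .seq p q, Q, s => p.wp W (q.wp W Q) s
  | .ite e p q, Q, s => (e.eval s ≠ 0 → p.wp W Q s) ∧ (e.eval s = 0 → q.wp W Q s)
  | .loop _ _, _, _ => False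

@[simp] theorem wp_setArr (W k : ℕ) (i e : RamExpr) (Q : RamState → Prop) (s : RamState) :
    (setArr k i e).wp W Q s ↔
      e.eval s ≤ W ∧ Q (s.setCol k (i.eval s) (e.eval s)) := Iff.rfl

@[simp] theorem wp_assign (W r : ℕ) (e : RamExpr) (Q : RamState → Prop) (s : RamState) :
    (assign r e).wp W Q s ↔ e.eval s ≤ W ∧ Q (s.set r (e.eval s)) := Iff.rfl

@[simp] theorem wp_skip (W : ℕ) (Q : RamState → Prop) (s : RamState) :
    skip.wp W Q s ↔ Q s := Iff.rfl

@[simp] theorem wp_seq (W : ℕ) (p q : RamProg) (Q : RamState → Prop) (s : RamState) :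
    (seq p q).wp W Q s ↔ p.wp W (q.wp W Q) s := Iff.rfl

@[simp] theorem wp_ite (W : ℕ) (e : RamExpr) (p q : RamProg) (Q : RamState → Prop)
    (s : RamState) : (ite e p q).wp W Q s ↔
      (e.eval s ≠ 0 → p.wp W Q s) ∧ (e.eval s = 0 → q.wp W Q s) := Iff.rfl

/-- Started in `s`, the program halts within `T` time units in a state that satisfies `Q`; no
number above `W ^ 64` occurs, and the final state is bounded by `W`. -/
def Run (W : ℕ) (p : RamProg) (s : RamState) (T : ℕ) (Q : RamState → Prop) : Prop :=
  ∃ t s', RamExec (W ^ 64) p s t s' ∧ t ≤ T ∧ s'.Bdd W ∧ Q s'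

theorem Run.mono {W : ℕ} {p : RamProg} {s : RamState} {T T' : ℕ} {Q Q' : RamState → Prop}
    (h : p.Run W s T Q) (hT : T ≤ T') (hQ : ∀ s', s'.Bdd W → Q s' → Q' s') :
    p.Run W s T' Q' := by
  obtain ⟨t, s', h1, h2, h3, h4⟩ := h
  exact ⟨t, s', h1, h2.trans hT, h3, hQ _ h3 h4⟩

theorem Run.seq {W : ℕ} {p q : RamProg} {s : RamState} {T₁ T₂ : ℕ} {P Q : RamState → Prop}
    (hp : p.Run W s T₁ P) (hq : ∀ s', s'.Bdd W → P s' → q.Run W s' T₂ Q) :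
    (RamProg.seq p q).Run W s (T₁ + T₂) Q := by
  obtain ⟨t, s', h1, h2, h3, h4⟩ := hp
  obtain ⟨t', s'', h1', h2', h3', h4'⟩ := hq s' h3 h4
  exact ⟨_, _, .seq h1 h1', by omega, h3', h4'⟩

theorem Run.ite {W : ℕ} (hW : 16 ≤ W) {e : RamExpr} {p q : RamProg} {s : RamState} {T : ℕ}
    {Q : RamState → Prop} (hs : s.Bdd W) (he : e.Small)
    (hp : e.eval s ≠ 0 → p.Run W s T Q) (hq : e.eval s = 0 → q.Run W s T Q) :
    (RamProg.ite e p q).Run W s (e.cost + 1 + T) Q := by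
  by_cases h : e.eval s = 0
  · obtain ⟨t, s', h1, h2, h3⟩ := hq h
    exact ⟨_, _, .ite_false (he.fits hW hs) h h1, by omega, h3⟩
  · obtain ⟨t, s', h1, h2, h3⟩ := hp h
    exact ⟨_, _, .ite_true (he.fits hW hs) h h1, by omega, h3⟩

theorem Run.of_wp {W : ℕ} (hW : 16 ≤ W) {p : RamProg} {s : RamState}
    {Q : RamState → Prop} (hs : s.Bdd W) (hp : p.Small) (h : p.wp W Q s) :
    p.Run W s p.time Q := by
  induction p generalizing s Q with
  | skip => exact ⟨_, _, .skip s, le_rfl, hs, h⟩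
  | assign r e => exact ⟨_, _, .assign s r e (hp.fits hW hs), le_rfl, hs.set h.1, h.2⟩
  | store a e =>
    exact ⟨_, _, .store s a e (hp.1.fits hW hs) (hp.2.fits hW hs), le_rfl,
      hs.update_mem h.1, h.2⟩
  | seq p q ihp ihq =>
    exact Run.seq (ihp hs hp.1 h) fun s' hs' h' => ihq hs' hp.2 h'
  | ite e p q ihp ihq =>
    exact Run.ite hW hs hp.1
      (fun he => (ihp hs hp.2.1 (h.1 he)).mono (le_max_left _ _) fun _ _ => id)
      (fun he => (ihq hs hp.2.2 (h.2 he)).mono (le_max_right _ _) fun _ _ => id)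
  | loop => exact h.elim

/-- The postcondition is replaced by an opaque `P`, so that simplification computes the final state
symbolically without entering the postcondition itself. -/
theorem Run.of_wp_forall {W : ℕ} (hW : 16 ≤ W) {p : RamProg} {s : RamState} {T : ℕ}
    {Q : RamState → Prop} (hs : s.Bdd W) (hp : p.Small) (hT : p.time ≤ T)
    (h : ∀ P : RamState → Prop, (∀ s', Q s' → P s') → p.wp W P s) : p.Run W s T Q :=
  (Run.of_wp hW hs hp (h Q fun _ => id)).mono hT fun _ _ => id

/-- The rule for loops: an invariant `I`, a measure `μ` that decreases with every round, and a
bound `T` for the time of a round. -/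
theorem Run.loop {W : ℕ} (hW : 16 ≤ W) {e : RamExpr} {p : RamProg} (he : e.Small)
    (I : RamState → Prop) (μ : RamState → ℕ) (T : ℕ)
    (hbody : ∀ s, s.Bdd W → I s → e.eval s ≠ 0 → p.Run W s T fun s' => I s' ∧ μ s' < μ s)
    {s : RamState} (hs : s.Bdd W) (hI : I s) :
    (RamProg.loop e p).Run W s (μ s * (e.cost + 1 + T) + (e.cost + 1))
      fun s' => I s' ∧ e.eval s' = 0 := by
  induction hm : μ s using Nat.strong_induction_on generalizing s with
  | _ m ih =>
    by_cases h : e.eval s = 0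
    · exact ⟨_, _, .loop_false (he.fits hW hs) h, by omega, hs, hI, h⟩
    · obtain ⟨t, s', h1, h2, h3, h4, h5⟩ := hbody s hs hI h
      obtain ⟨t', s'', h1', h2', h3'⟩ := ih (μ s') (hm ▸ h5) h3 h4 rfl
      refine ⟨_, _, .loop_true (he.fits hW hs) h h1 h1', ?_, h3'⟩
      -- The drop of the measure pays for one test and one body; the failing last test is the
      -- summand outside the product.
      have : (μ s' + 1) * (e.cost + 1 + T) ≤ m * (e.cost + 1 + T) :=
        Nat.mul_le_mul_right _ (by omega)
      nlinarith

end RamProg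

/-! ## The primal-dual method for the cluster-intersection graph -/

open Finset in
/-- The numbers below `n` are partitioned by `a` (each part is named by its least element) and
by `b`; `w z` is the size of the intersection of the two parts of `z`, and `nx z` is the next
element of the `a`-part of `z`, or `n` if there is none. -/
structure OverlapData (n : ℕ) (a b w nx : ℕ → ℕ) : Prop where
  a_le : ∀ z < n, a z ≤ z
  a_idem : ∀ z < n, a (a z) = a z
  b_lt : ∀ z < n, b z < n
  w_eq : ∀ z < n, w z = #{j ∈ range n | a j = a z ∧ b j = b z}
  nx_gt : ∀ z < n, z < nx z
  nx_le : ∀ z < n, nx z ≤ n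
  nx_a : ∀ z < n, nx z < n → a (nx z) = a z
  nx_min : ∀ z < n, ∀ j < n, z < j → a j = a z → nx z ≤ j

/-- A cover `u`, `v` of the weights and a matching of tight edges. The matching is stored on the
left in `ml` and on the right in `mr`, where `z + 1` stands for the edge `z` and `0` for an
unmatched vertex; the entry of `cur` on the right is ignored, and `cur` counts as unmatched. -/
structure PrimalDual (n : ℕ) (a b w u v ml mr : ℕ → ℕ) (r cur : ℕ) : Prop where
  cover : ∀ z < n, w z ≤ u (a z) + v (b z)
  left : ∀ x < n, ∀ z, ml x = z + 1 →
    z < n ∧ a z = x ∧ b z ≠ cur ∧ mr (b z) = z + 1 ∧ u x + v (b z) = w z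
  right : ∀ y < n, y ≠ cur → ∀ z, mr y = z + 1 → z < n ∧ b z = y ∧ ml (a z) = z + 1
  processed : ∀ x < r, ml x ≠ 0 ∨ u x = 0
  matched : ∀ y < n, v y ≠ 0 → mr y ≠ 0

/-- The vertices `y` on the right with `vis y ≠ 0`, up to the rank `vis cur`, have been reached
from `r` by alternating paths of tight edges, the last edge being `pred y`. -/
structure SearchTree (n : ℕ) (a b w u v ml : ℕ → ℕ) (r : ℕ) (vis pred : ℕ → ℕ) (cur : ℕ) :
    Prop where
  cur_lt : cur < n
  vis_cur : vis cur ≠ 0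
  pred_lt : ∀ y < n, vis y ≠ 0 → vis y ≤ vis cur → pred y < n
  b_pred : ∀ y < n, vis y ≠ 0 → vis y ≤ vis cur → b (pred y) = y
  tight : ∀ y < n, vis y ≠ 0 → vis y ≤ vis cur → u (a (pred y)) + v y = w (pred y)
  parent : ∀ y < n, vis y ≠ 0 → vis y ≤ vis cur → (a (pred y) = r ∧ ml r = 0) ∨
    (ml (a (pred y)) ≠ 0 ∧ vis (b (ml (a (pred y)) - 1)) ≠ 0 ∧
      vis (b (ml (a (pred y)) - 1)) < vis y)

namespace OverlapData

variable {n : ℕ} {a b w nx : ℕ → ℕ} (hd : OverlapData n a b w nx)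
include hd

theorem a_lt {z : ℕ} (hz : z < n) : a z < n := (hd.a_le z hz).trans_lt hz

theorem w_le {z : ℕ} (hz : z < n) : w z ≤ n := by
  rw [hd.w_eq z hz]
  exact (Finset.card_filter_le _ _).trans (by simp)

end OverlapData

/-! ### Augmenting paths and linear programming duality -/

namespace PrimalDual

variable {n : ℕ} {a b w nx u v ml mr vis pred : ℕ → ℕ} {r cur : ℕ}

/-- The current vertex takes its tree edge; if the other end of this edge was unmatched, the
matching is complete. -/
theorem augment_last (hd : OverlapData n a b w nx) (h : PrimalDual n a b w u v ml mr r cur)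
    (ht : SearchTree n a b w u v ml r vis pred cur) (h0 : ml (a (pred cur)) = 0) :
    a (pred cur) = r ∧ PrimalDual n a b w u v (Function.update ml (a (pred cur)) (pred cur + 1))
      (Function.update mr cur (pred cur + 1)) r n := by
  have hp := ht.pred_lt cur ht.cur_lt ht.vis_cur le_rfl
  have hb := ht.b_pred cur ht.cur_lt ht.vis_cur le_rfl
  have htt := ht.tight cur ht.cur_lt ht.vis_cur le_rfl
  refine ⟨?_, h.cover, fun x hx z hz => ?_, fun y hy _ z hz => ?_, fun x hx => ?_, fun y hy hv => ?_⟩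
  · rcases ht.parent cur ht.cur_lt ht.vis_cur le_rfl with h1 | h1
    · exact h1.1
    · exact absurd h0 h1.1
  · by_cases e : x = a (pred cur)
    · subst e
      have : z = pred cur := by simpa using hz.symm
      subst this
      exact ⟨hp, rfl, (hd.b_lt _ hp).ne, by simp [hb], by rw [hb]; exact htt⟩
    · rw [Function.update_of_ne e] at hz
      obtain ⟨h1, h2, h3, h4, h5⟩ := h.left x hx z hz
      exact ⟨h1, h2, (hd.b_lt _ h1).ne, by rwa [Function.update_of_ne h3], h5⟩
  · by_cases e : y = cur
    · subst e
      have : z = pred y := by simpa using hz.symm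
      subst this
      exact ⟨hp, hb, by simp⟩
    · rw [Function.update_of_ne e] at hz
      obtain ⟨h1, h2, h3⟩ := h.right y hy e z hz
      refine ⟨h1, h2, ?_⟩
      rw [Function.update_of_ne]
      · exact h3
      · intro e'
        rw [e', h0] at h3
        omega
  · by_cases e : x = a (pred cur)
    · subst e; simp
    · rw [Function.update_of_ne e]; exact h.processed x hx
  · by_cases e : y = cur
    · subst e; simp
    · rw [Function.update_of_ne e]; exact h.matched y hy hv

/-- The current vertex takes its tree edge, whose other end was matched: the previous partner
becomes the current vertex. -/
theorem augment_step (hd : OverlapData n a b w nx) (h : PrimalDual n a b w u v ml mr r cur)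
    (ht : SearchTree n a b w u v ml r vis pred cur) (h0 : ml (a (pred cur)) ≠ 0) :
    let y := b (ml (a (pred cur)) - 1)
    vis y < vis cur ∧
    PrimalDual n a b w u v (Function.update ml (a (pred cur)) (pred cur + 1))
      (Function.update mr cur (pred cur + 1)) r y ∧
    SearchTree n a b w u v (Function.update ml (a (pred cur)) (pred cur + 1)) r vis pred y := by
  intro y
  have hp := ht.pred_lt cur ht.cur_lt ht.vis_cur le_rfl
  have hb := ht.b_pred cur ht.cur_lt ht.vis_cur le_rfl
  have htt := ht.tight cur ht.cur_lt ht.vis_cur le_rfl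
  obtain ⟨z₀, hz₀⟩ := Nat.exists_eq_succ_of_ne_zero h0
  have hy : y = b z₀ := by simp [y, hz₀]
  have hpar : vis y ≠ 0 ∧ vis y < vis cur := by
    rcases ht.parent cur ht.cur_lt ht.vis_cur le_rfl with h1 | h1
    · rw [h1.1] at h0; exact absurd h1.2 h0
    · exact h1.2
  obtain ⟨hz1, hz2, hz3, hz4, hz5⟩ := h.left _ (hd.a_lt hp) z₀ hz₀
  refine ⟨hpar.2, ⟨h.cover, fun x hx z hz => ?_, fun y' hy' hyy z hz => ?_, fun x hx => ?_,
    fun y hy hv => ?_⟩, ⟨?_, hpar.1, ?_, ?_, ?_, ?_⟩⟩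
  · by_cases e : x = a (pred cur)
    · subst e
      have : z = pred cur := by simpa using hz.symm
      subst this
      refine ⟨hp, rfl, ?_, by simp [hb], by rw [hb]; exact htt⟩
      rw [hb]; intro e; exact hpar.2.ne (congrArg vis e.symm)
    · rw [Function.update_of_ne e] at hz
      obtain ⟨h1, h2, h3, h4, h5⟩ := h.left x hx z hz
      refine ⟨h1, h2, ?_, by rwa [Function.update_of_ne h3], h5⟩
      intro e'
      rw [e', hy, hz4] at h4
      obtain rfl : z₀ = z := by omega
      exact e (h2.symm.trans hz2)
  · by_cases e : y' = cur
    · rw [e, Function.update_self] at hz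
      obtain rfl : z = pred cur := by omega
      exact ⟨hp, hb.trans e.symm, by simp⟩
    · rw [Function.update_of_ne e] at hz
      obtain ⟨h1, h2, h3⟩ := h.right y' hy' e z hz
      refine ⟨h1, h2, ?_⟩
      rw [Function.update_of_ne]
      · exact h3
      · intro e'
        rw [e', hz₀] at h3
        obtain rfl : z₀ = z := by omega
        exact hyy (h2.symm.trans hy.symm)
  · by_cases e : x = a (pred cur)
    · subst e; simp
    · rw [Function.update_of_ne e]; exact h.processed x hx
  · by_cases e : y = cur
    · rw [e]; simp
    · rw [Function.update_of_ne e]; exact h.matched y hy hv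
  · rw [hy]; exact hd.b_lt _ hz1
  · exact fun y' h1 h2 h3 => ht.pred_lt y' h1 h2 (h3.trans hpar.2.le)
  · exact fun y' h1 h2 h3 => ht.b_pred y' h1 h2 (h3.trans hpar.2.le)
  · exact fun y' h1 h2 h3 => ht.tight y' h1 h2 (h3.trans hpar.2.le)
  · intro y' h1 h2 h3
    have key := ht.parent y' h1 h2 (h3.trans hpar.2.le)
    -- The rewritten left vertex is no parent in the remaining tree: its former partner has the rank
    -- of the new current vertex, and children have larger rank.
    have hne : a (pred y') ≠ a (pred cur) := by
      intro e
      rw [e] at key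
      rcases key with h4 | h4
      · rw [h4.1] at h0; exact h0 h4.2
      · exact absurd h3 (not_le.2 h4.2.2)
    rw [Function.update_of_ne hne]
    rcases key with h4 | h4
    · left
      refine ⟨h4.1, ?_⟩
      rw [Function.update_of_ne (by rw [← h4.1]; exact hne)]
      exact h4.2
    · exact Or.inr h4

/-- A free vertex on the right may serve as the current vertex. -/
theorem of_free (h : PrimalDual n a b w u v ml mr r n) (h0 : mr cur = 0) :
    PrimalDual n a b w u v ml mr r cur := by
  refine ⟨h.cover, fun x hx z hz => ?_, fun y hy _ z hz => h.right y hy hy.ne z hz, h.processed,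
    h.matched⟩
  obtain ⟨h1, h2, -, h4, h5⟩ := h.left x hx z hz
  refine ⟨h1, h2, ?_, h4, h5⟩
  rintro rfl
  omega

/-- A vertex on the left of potential `0` may be unmatched. -/
theorem drop (h : PrimalDual n a b w u v ml mr r n)
    (ht : SearchTree n a b w u v ml r vis pred cur) (h0 : mr cur ≠ 0)
    (hu : u (a (mr cur - 1)) = 0) :
    PrimalDual n a b w u v (Function.update ml (a (mr cur - 1)) 0) mr r cur ∧
    SearchTree n a b w u v (Function.update ml (a (mr cur - 1)) 0) r vis pred cur := by
  obtain ⟨z₀, hz₀⟩ := Nat.exists_eq_succ_of_ne_zero h0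
  simp only [hz₀, Nat.succ_eq_add_one, Nat.add_sub_cancel] at hu ⊢
  obtain ⟨h1, h2, h3⟩ := h.right cur ht.cur_lt ht.cur_lt.ne z₀ hz₀
  refine ⟨⟨h.cover, fun x hx z hz => ?_, fun y hy hyc z hz => ?_, fun x hx => ?_, h.matched⟩,
    ⟨ht.cur_lt, ht.vis_cur, ht.pred_lt, ht.b_pred, ht.tight, fun y hy hv hv' => ?_⟩⟩
  · by_cases e : x = a z₀
    · subst e; simp at hz
    · rw [Function.update_of_ne e] at hz
      obtain ⟨h4, h5, -, h6, h7⟩ := h.left x hx z hz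
      refine ⟨h4, h5, ?_, h6, h7⟩
      intro e'
      rw [e', hz₀] at h6
      obtain rfl : z₀ = z := by omega
      exact e h5.symm
  · obtain ⟨h4, h5, h6⟩ := h.right y hy hy.ne z hz
    refine ⟨h4, h5, ?_⟩
    rw [Function.update_of_ne]
    · exact h6
    · intro e
      rw [e, h3] at h6
      obtain rfl : z₀ = z := by omega
      exact hyc (h5.symm.trans h2)
  · by_cases e : x = a z₀
    · subst e; exact Or.inr hu
    · rw [Function.update_of_ne e]; exact h.processed x hx
  · have key := ht.parent y hy hv hv'
    -- The released vertex was matched to `cur`. It is not the root, which is unmatched, and as a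
    -- parent it would force `vis cur < vis y`.
    have hne : a (pred y) ≠ a z₀ := by
      intro e
      rw [e, h3] at key
      rcases key with h4 | h4
      · rw [← h4.1, h3] at h4; omega
      · simp only [Nat.add_sub_cancel, h2] at h4
        omega
    rw [Function.update_of_ne hne]
    rcases key with h4 | h4
    · left
      refine ⟨h4.1, ?_⟩
      rw [Function.update_of_ne (by rw [← h4.1]; exact hne)]
      exact h4.2
    · exact Or.inr h4

/-- Potentials matter only below `n`, which is all that the dual update guarantees about its arrays.
-/
theorem congr (hd : OverlapData n a b w nx) (h : PrimalDual n a b w u v ml mr r cur) (hr : r ≤ n)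
    {u' v' : ℕ → ℕ} (hu : ∀ i < n, u' i = u i) (hv : ∀ i < n, v' i = v i) :
    PrimalDual n a b w u' v' ml mr r cur := by
  refine ⟨fun z hz => ?_, fun x hx z hz => ?_, h.right, fun x hx => ?_, fun y hy hvy => ?_⟩
  · rw [hu _ (hd.a_lt hz), hv _ (hd.b_lt z hz)]; exact h.cover z hz
  · have := h.left x hx z hz
    rwa [hu x hx, hv _ (hd.b_lt z this.1)]
  · rw [hu x (hx.trans_le hr)]; exact h.processed x hx
  · rw [hv y hy] at hvy; exact h.matched y hy hvy

/-- The right potentials are at most `n`. -/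
theorem v_le (hd : OverlapData n a b w nx) (h : PrimalDual n a b w u v ml mr r n)
    {y : ℕ} (hy : y < n) : v y ≤ n := by
  by_cases hv : v y = 0
  · omega
  · obtain ⟨z, hz⟩ := Nat.exists_eq_succ_of_ne_zero (h.matched y hy hv)
    obtain ⟨h1, h2, h3⟩ := h.right y hy hy.ne z hz
    obtain ⟨-, -, -, -, h5⟩ := h.left _ (hd.a_lt h1) z h3
    rw [h2] at h5
    have := hd.w_le h1
    omega

open Finset in
/-- Weak duality: the cover bounds every set on which the two partitions agree. -/
theorem card_le (hd : OverlapData n a b w nx) (h : PrimalDual n a b w u v ml mr r cur)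
    {K : Finset ℕ} (hK : K ⊆ range n) (hab : ∀ z ∈ K, ∀ z' ∈ K, a z = a z' ↔ b z = b z') :
    #K ≤ ∑ j ∈ range n, (u j + v j) := by
  have hlt : ∀ z ∈ K, z < n := fun z hz => mem_range.1 (hK hz)
  have hex : ∀ x, ∃ z, x ∈ K.image a → z ∈ K ∧ a z = x := by
    intro x
    by_cases hx : x ∈ K.image a
    · obtain ⟨z, hz⟩ := mem_image.1 hx
      exact ⟨z, fun _ => hz⟩
    · exact ⟨0, fun h => absurd h hx⟩
  -- `ρ x` is a vertex of `K` in the left part `x`. All of `K` in this part lies in one right part,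
  -- so `ρ x` represents the only relevant edge at `x`.
  choose ρ hρ using hex
  calc #K = ∑ x ∈ K.image a, #{z ∈ K | a z = x} := card_eq_sum_card_image a K
    _ ≤ ∑ x ∈ K.image a, (u x + v (b (ρ x))) := by
      refine sum_le_sum fun x hx => ?_
      obtain ⟨h1, h2⟩ := hρ x hx
      have h3 := h.cover _ (hlt _ h1)
      rw [h2, hd.w_eq _ (hlt _ h1)] at h3
      refine (card_le_card fun z hz => ?_).trans h3
      obtain ⟨h4, h5⟩ := mem_filter.1 hz
      have h6 : a z = a (ρ x) := h5.trans h2.symm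
      exact mem_filter.2 ⟨hK h4, h6, (hab z h4 _ h1).1 h6⟩
    _ = ∑ x ∈ K.image a, u x + ∑ y ∈ (K.image a).image (b ∘ ρ), v y := by
      -- Agreement on `K` makes `b ∘ ρ` injective, so no right potential is used twice.
      rw [sum_add_distrib, sum_image (f := v)]
      · rfl
      · intro x hx x' hx' e
        obtain ⟨h1, h2⟩ := hρ x hx
        obtain ⟨h1', h2'⟩ := hρ x' hx'
        rw [← h2, ← h2']
        exact (hab _ h1 _ h1').2 e
    _ ≤ ∑ j ∈ range n, u j + ∑ j ∈ range n, v j := by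
      refine add_le_add (sum_le_sum_of_subset fun x hx => ?_) (sum_le_sum_of_subset fun y hy => ?_)
      · obtain ⟨h1, h2⟩ := hρ x hx
        exact mem_range.2 (h2 ▸ hd.a_lt (hlt _ h1))
      · obtain ⟨x, hx, rfl⟩ := mem_image.1 hy
        exact mem_range.2 (hd.b_lt _ (hlt _ (hρ x hx).1))
    _ = _ := sum_add_distrib.symm

open Finset in
/-- Strong duality: when every vertex on the left has been processed, some set on which the two
partitions agree attains the cover. -/
theorem exists_le_card (hd : OverlapData n a b w nx) (h : PrimalDual n a b w u v ml mr n n) :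
    ∃ K ⊆ range n, (∀ z ∈ K, ∀ z' ∈ K, a z = a z' ↔ b z = b z') ∧
      ∑ j ∈ range n, (u j + v j) ≤ #K := by
  have hl : ∀ x < n, ml x ≠ 0 → ml x - 1 < n ∧ a (ml x - 1) = x ∧ mr (b (ml x - 1)) = ml x ∧
      u x + v (b (ml x - 1)) = w (ml x - 1) := by
    intro x hx hm
    obtain ⟨z, hz⟩ := Nat.exists_eq_succ_of_ne_zero hm
    obtain ⟨h1, h2, -, h3, h4⟩ := h.left x hx z hz
    simpa [hz] using ⟨h1, h2, h3, h4⟩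
  have hr : ∀ y < n, mr y ≠ 0 → mr y - 1 < n ∧ b (mr y - 1) = y ∧ ml (a (mr y - 1)) = mr y := by
    intro y hy hm
    obtain ⟨z, hz⟩ := Nat.exists_eq_succ_of_ne_zero hm
    simpa [hz] using h.right y hy hy.ne z hz
  -- The union of the intersections along the stored matching.
  refine ⟨{z ∈ range n | ml (a z) ≠ 0 ∧ b z = b (ml (a z) - 1)}, filter_subset _ _, ?_, ?_⟩
  · intro z hz z' hz'
    simp only [mem_filter, mem_range] at hz hz'
    obtain ⟨h1, h2, h3⟩ := hz
    obtain ⟨h1', h2', h3'⟩ := hz'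
    constructor
    · intro e; rw [h3, h3', e]
    · intro e
      obtain ⟨-, h4, h5, -⟩ := hl _ (hd.a_lt h1) h2
      obtain ⟨-, h4', h5', -⟩ := hl _ (hd.a_lt h1') h2'
      rw [← h3, e, h3', h5'] at h5
      rw [← h4, ← h4', h5]
  -- Unmatched right vertices have potential zero, so the right sum can be moved along the matching
  -- to the left. There `u + v` is the weight of the matched edge, which is the size of its fibre in
  -- `K`.
  · have hv : ∑ y ∈ range n, v y = ∑ x ∈ range n with ml x ≠ 0, v (b (ml x - 1)) := by
      have : ∑ y ∈ range n, v y = ∑ y ∈ range n with mr y ≠ 0, v y := by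
        refine (sum_filter_of_ne fun y hy hne => h.matched y (mem_range.1 hy) hne).symm
      rw [this]
      refine sum_bij' (fun y _ => a (mr y - 1)) (fun x _ => b (ml x - 1)) ?_ ?_ ?_ ?_ ?_
      · intro y hy
        simp only [mem_filter, mem_range] at hy ⊢
        obtain ⟨h1, h2, h3⟩ := hr y hy.1 hy.2
        exact ⟨hd.a_lt h1, by rw [h3]; exact hy.2⟩
      · intro x hx
        simp only [mem_filter, mem_range] at hx ⊢
        obtain ⟨h1, h2, h3, -⟩ := hl x hx.1 hx.2
        exact ⟨hd.b_lt _ h1, by rw [h3]; exact hx.2⟩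
      · intro y hy
        simp only [mem_filter, mem_range] at hy
        obtain ⟨h1, h2, h3⟩ := hr y hy.1 hy.2
        simp only [h3, h2]
      · intro x hx
        simp only [mem_filter, mem_range] at hx
        obtain ⟨h1, h2, h3, -⟩ := hl x hx.1 hx.2
        simp only [h3, h2]
      · intro y hy
        simp only [mem_filter, mem_range] at hy
        obtain ⟨h1, h2, h3⟩ := hr y hy.1 hy.2
        simp only [h3, h2]
    rw [sum_add_distrib, hv, sum_filter, ← sum_add_distrib,
      card_eq_sum_card_fiberwise (f := a) (t := range n)]
    · refine sum_le_sum fun x hx => ?_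
      rw [mem_range] at hx
      by_cases hm : ml x = 0
      · have := h.processed x hx
        simp [hm] at this
        simp [hm, this]
      · obtain ⟨h1, h2, h3, h4⟩ := hl x hx hm
        rw [if_pos hm, h4, hd.w_eq _ h1, h2]
        refine card_le_card fun z hz => ?_
        simp only [mem_filter, mem_range] at hz ⊢
        obtain ⟨h5, h6, h7⟩ := hz
        exact ⟨⟨h5, by rw [h6]; exact hm, by rw [h6, h7]⟩, h6⟩
    · intro z hz
      simp only [coe_filter, mem_range, Set.mem_ofPred_eq] at hz
      simpa using hd.a_lt hz.1

end PrimalDual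

/-! ### The search for an augmenting path -/

open Finset in
/-- The edges that have been scanned when the search is at the edge `z` of `Q h`. -/
def scanned (n : ℕ) (a Q : ℕ → ℕ) (h t z : ℕ) : Finset ℕ :=
  {z' ∈ range n | (∃ i < h, a z' = Q i) ∨ (h < t ∧ a z' = Q h ∧ z' < z)}

/-- The state of the breadth-first search from `r`: the vertices on the left that have been
reached are `Q 0, …, Q (t - 1)`, and the edge to be scanned next is the edge `z` of `Q h`. -/
structure SearchState (n : ℕ) (a b w u v ml mr : ℕ → ℕ) (r : ℕ) (vis pred Q : ℕ → ℕ)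
    (h t z : ℕ) : Prop where
  le : h ≤ t
  pos : 0 < t
  root : Q 0 = r
  free : ml r = 0
  edge : h < t → z < n ∧ a z = Q h
  queue : ∀ i < t, 0 < i → ml (Q i) ≠ 0 ∧ vis (b (ml (Q i) - 1)) = i
  rep : ∀ i < t, Q i < n ∧ a (Q i) = Q i
  pot : ∀ i < t, u (Q i) ≠ 0
  reached : ∀ y < n, vis y ≠ 0 → vis y < t ∧ mr y ≠ 0 ∧ Q (vis y) = a (mr y - 1)
  pred : ∀ y < n, vis y ≠ 0 → pred y < n ∧ b (pred y) = y ∧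
    u (a (pred y)) + v y = w (pred y) ∧ ∃ i < vis y, a (pred y) = Q i
  closed : ∀ z' ∈ scanned n a Q h t z, u (a z') + v (b z') = w z' → vis (b z') ≠ 0

namespace SearchState

variable {n : ℕ} {a b w nx u v ml mr vis pred Q : ℕ → ℕ} {r h t z : ℕ}

theorem init (hr : r < n) (ha : a r = r) (hle : ∀ z < n, a z ≤ z) (hu : u r ≠ 0)
    (hm : ml r = 0) (hQ : Q 0 = r) (hvis : ∀ y < n, vis y = 0) :
    SearchState n a b w u v ml mr r vis pred Q 0 1 r where
  le := Nat.zero_le _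
  pos := one_pos
  root := hQ
  free := hm
  edge _ := ⟨hr, by rw [hQ, ha]⟩
  queue i h1 h2 := by omega
  rep i hi := by
    obtain rfl : i = 0 := by omega
    rw [hQ]; exact ⟨hr, ha⟩
  pot i hi := by
    obtain rfl : i = 0 := by omega
    rwa [hQ]
  reached y hy hv := absurd (hvis y hy) hv
  pred y hy hv := absurd (hvis y hy) hv
  closed z' hz' _ := by
    simp only [scanned, Finset.mem_filter, Finset.mem_range, hQ] at hz'
    obtain ⟨h1, ⟨i, hi, -⟩ | ⟨-, h2, h3⟩⟩ := hz'
    -- The root is the least element of its part, so nothing precedes the first edge scanned.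
    · omega
    · have := hle z' h1
      omega

/-- The root is unmatched, while the entry at a later position `i` is matched to a right vertex
whose mark is `i`. -/
theorem queue_inj (hs : SearchState n a b w u v ml mr r vis pred Q h t z) {i j : ℕ}
    (hi : i < t) (hj : j < t) (e : Q i = Q j) : i = j := by
  rcases Nat.eq_zero_or_pos i with rfl | hi0 <;> rcases Nat.eq_zero_or_pos j with rfl | hj0
  · rfl
  · have := (hs.queue j hj hj0).1
    rw [← e, hs.root] at this
    exact absurd hs.free this
  · have := (hs.queue i hi hi0).1
    rw [e, hs.root] at this
    exact absurd hs.free this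
  · have h1 := (hs.queue i hi hi0).2
    have h2 := (hs.queue j hj hj0).2
    rw [e] at h1
    omega

theorem not_mem_scanned (hs : SearchState n a b w u v ml mr r vis pred Q h t z) (hht : h < t) :
    z ∉ scanned n a Q h t z := by
  simp only [scanned, Finset.mem_filter, not_and, not_or]
  refine fun _ => ⟨?_, fun h => by omega⟩
  rintro ⟨i, hi, e⟩
  have := hs.queue_inj (hi.trans hht) hht (e.symm.trans (hs.edge hht).2)
  omega

/-- The edges that count as scanned after `z`. -/
theorem mem_scanned_next (hd : OverlapData n a b w nx)
    (hs : SearchState n a b w u v ml mr r vis pred Q h t z) (hht : h < t) {z' : ℕ} :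
    z' ∈ (if nx z = n then scanned n a Q (h + 1) t (Q (h + 1)) else scanned n a Q h t (nx z)) ↔
      z' = z ∨ z' ∈ scanned n a Q h t z := by
  obtain ⟨hz, haz⟩ := hs.edge hht
  -- No element of the part of `Q h` lies strictly between `z` and `nx z`.
  have key (h1 : z' < n) (h2 : a z' = Q h) (h3 : z' < nx z) : z' = z ∨ z' < z := by
    by_contra! hlt
    have := hd.nx_min z hz z' h1 (by omega) (h2.trans haz.symm)
    omega
  have hgt := hd.nx_gt z hz
  split_ifs with hn
  · simp only [scanned, Finset.mem_filter, Finset.mem_range]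
    constructor
    · rintro ⟨h1, ⟨i, hi, e⟩ | ⟨h2, h3, h4⟩⟩
      · by_cases hi' : i = h
        · subst hi'
          rcases key h1 e (by omega) with h5 | h5
          · exact Or.inl h5
          · exact Or.inr ⟨h1, Or.inr ⟨hht, e, h5⟩⟩
        · exact Or.inr ⟨h1, Or.inl ⟨i, by omega, e⟩⟩
      -- The scan of the next part begins at its least element, so none of its edges counts as
      -- scanned yet.
      · have := hd.a_le z' h1
        omega
    · rintro (rfl | ⟨h1, ⟨i, hi, e⟩ | ⟨h2, h3, h4⟩⟩)
      · exact ⟨hz, Or.inl ⟨h, by omega, haz⟩⟩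
      · exact ⟨h1, Or.inl ⟨i, by omega, e⟩⟩
      · exact ⟨h1, Or.inl ⟨h, by omega, h3⟩⟩
  · simp only [scanned, Finset.mem_filter, Finset.mem_range]
    constructor
    · rintro ⟨h1, h2 | ⟨h2, h3, h4⟩⟩
      · exact Or.inr ⟨h1, Or.inl h2⟩
      · rcases key h1 h3 h4 with h5 | h5
        · exact Or.inl h5
        · exact Or.inr ⟨h1, Or.inr ⟨hht, h3, h5⟩⟩
    · rintro (rfl | ⟨h1, h2 | ⟨h2, h3, h4⟩⟩)
      · exact ⟨hz, Or.inr ⟨hht, haz, hgt⟩⟩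
      · exact ⟨h1, Or.inl h2⟩
      · exact ⟨h1, Or.inr ⟨h2, h3, by omega⟩⟩

/-- Every advance adds precisely the current edge, which was not scanned before. This makes the
number of scanned edges the measure of the search. -/
theorem card_scanned_next (hd : OverlapData n a b w nx)
    (hs : SearchState n a b w u v ml mr r vis pred Q h t z) (hht : h < t) :
    (scanned n a Q h t z).card < (if nx z = n then scanned n a Q (h + 1) t (Q (h + 1)) else
      scanned n a Q h t (nx z)).card := by
  refine Finset.card_lt_card ⟨fun z' hz' => (hs.mem_scanned_next hd hht).2 (Or.inr hz'), ?_⟩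
  exact fun hsub => hs.not_mem_scanned hht (hsub ((hs.mem_scanned_next hd hht).2 (Or.inl rfl)))

/-- When the current edge has been dealt with, the search moves on within the part of `Q h`. -/
theorem next_edge (hd : OverlapData n a b w nx)
    (hs : SearchState n a b w u v ml mr r vis pred Q h t z) (hht : h < t)
    (hz : u (a z) + v (b z) = w z → vis (b z) ≠ 0) (hn : nx z ≠ n) :
    SearchState n a b w u v ml mr r vis pred Q h t (nx z) := by
  obtain ⟨h1, h2⟩ := hs.edge hht
  have hlt : nx z < n := lt_of_le_of_ne (hd.nx_le z h1) hn
  refine { hs with edge := fun _ => ⟨hlt, (hd.nx_a z h1 hlt).trans h2⟩, closed := ?_ }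
  intro z' hz'
  have := hs.mem_scanned_next hd hht (z' := z')
  rw [if_neg hn] at this
  rcases this.1 hz' with rfl | h3
  · exact hz
  · exact hs.closed z' h3

/-- When the current edge has been dealt with and was the last one, the search moves on to the
next vertex of the queue. -/
theorem next_vertex (hd : OverlapData n a b w nx)
    (hs : SearchState n a b w u v ml mr r vis pred Q h t z) (hht : h < t)
    (hz : u (a z) + v (b z) = w z → vis (b z) ≠ 0) (hn : nx z = n) :
    SearchState n a b w u v ml mr r vis pred Q (h + 1) t (Q (h + 1)) := by
  refine { hs with le := hht, edge := hs.rep (h + 1), closed := ?_ }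
  intro z' hz'
  have := hs.mem_scanned_next hd hht (z' := z')
  rw [if_pos hn] at this
  rcases this.1 hz' with rfl | h3
  · exact hz
  · exact hs.closed z' h3

/-- Only queue positions up to `h < t` determine what has been scanned. -/
theorem scanned_update (hht : h < t) (x : ℕ) :
    scanned n a (Function.update Q t x) h (t + 1) z = scanned n a Q h t z := by
  ext z'
  simp only [scanned, Finset.mem_filter]
  have h1 : Function.update Q t x h = Q h := Function.update_of_ne hht.ne _ _
  have h2 : (∃ i < h, a z' = Function.update Q t x i) ↔ ∃ i < h, a z' = Q i := by
    refine exists_congr fun i => and_congr_right fun hi => ?_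
    rw [Function.update_of_ne (by omega)]
  rw [h1, h2]
  simp [hht, Nat.lt_succ_of_lt hht]

/-- A tight edge to a new vertex that is matched to a vertex of positive potential. -/
theorem push (hd : OverlapData n a b w nx) (hp : PrimalDual n a b w u v ml mr r n)
    (hs : SearchState n a b w u v ml mr r vis pred Q h t z) (hht : h < t)
    (hz : u (a z) + v (b z) = w z) (hv : vis (b z) = 0) (hm : mr (b z) ≠ 0)
    (hu : u (a (mr (b z) - 1)) ≠ 0) :
    SearchState n a b w u v ml mr r (Function.update vis (b z) t) (Function.update pred (b z) z)
      (Function.update Q t (a (mr (b z) - 1))) h (t + 1) z := by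
  obtain ⟨hzn, haz⟩ := hs.edge hht
  have hbn := hd.b_lt z hzn
  obtain ⟨z₀, hz₀⟩ := Nat.exists_eq_succ_of_ne_zero hm
  obtain ⟨h1, h2, h3⟩ := hp.right _ hbn hbn.ne z₀ hz₀
  simp only [hz₀, Nat.succ_eq_add_one, Nat.add_sub_cancel] at hu ⊢
  have hvis : ∀ i < t, vis (b z) ≠ i → 0 < i →
      b (ml (Q i) - 1) ≠ b z := by
    intro i hi hne hi0 e
    have := (hs.queue i hi hi0).2
    rw [e] at this
    exact hne this
  refine ⟨by have := hs.le; omega, by omega, ?_, hs.free, fun _ => ?_, ?_, ?_, ?_, ?_, ?_, ?_⟩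
  · rw [Function.update_of_ne hs.pos.ne]; exact hs.root
  · rw [Function.update_of_ne hht.ne]; exact ⟨hzn, haz⟩
  · intro i hi hi0
    by_cases e : i = t
    · subst e
      simp [h3, h2]
    · rw [Function.update_of_ne e, Function.update_of_ne]
      · exact hs.queue i (by omega) hi0
      · exact hvis i (by omega) (by omega) hi0
  · intro i hi
    by_cases e : i = t
    · subst e
      simpa using ⟨hd.a_lt h1, hd.a_idem _ h1⟩
    · rw [Function.update_of_ne e]; exact hs.rep i (by omega)
  · intro i hi
    by_cases e : i = t
    · subst e
      simpa using hu
    · rw [Function.update_of_ne e]; exact hs.pot i (by omega)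
  · intro y hy hvy
    by_cases e : y = b z
    · subst e
      simp [hz₀]
    · rw [Function.update_of_ne e] at hvy ⊢
      obtain ⟨h4, h5, h6⟩ := hs.reached y hy hvy
      exact ⟨by omega, h5, by rw [Function.update_of_ne h4.ne]; exact h6⟩
  · intro y hy hvy
    by_cases e : y = b z
    · subst e
      simp only [Function.update_self]
      exact ⟨hzn, trivial, hz, h, hht, by rw [Function.update_of_ne hht.ne]; exact haz⟩
    · rw [Function.update_of_ne e] at hvy ⊢
      rw [Function.update_of_ne e]
      obtain ⟨h4, h5, h6, i, hi, h7⟩ := hs.pred y hy hvy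
      have := (hs.reached y hy hvy).1
      exact ⟨h4, h5, h6, i, hi, by rw [Function.update_of_ne (by omega)]; exact h7⟩
  · intro z' hz' htt
    rw [scanned_update hht] at hz'
    by_cases e : b z' = b z
    -- The new mark `t` is nonzero because position `0` belongs to the root; hence the mark `0` can
    -- mean "not reached".
    · rw [e, Function.update_self]; exact hs.pos.ne'
    · rw [Function.update_of_ne e]; exact hs.closed z' hz' htt

/-- A tight edge to a new vertex closes a search tree. -/
theorem searchTree (hd : OverlapData n a b w nx)
    (hs : SearchState n a b w u v ml mr r vis pred Q h t z) (hht : h < t)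
    (hz : u (a z) + v (b z) = w z) (hv : vis (b z) = 0) :
    SearchTree n a b w u v ml r (Function.update vis (b z) t) (Function.update pred (b z) z)
      (b z) := by
  obtain ⟨hzn, haz⟩ := hs.edge hht
  have hbn := hd.b_lt z hzn
  -- A queue vertex is the root or is matched to a right vertex whose rank is its position, so ranks
  -- decrease towards the root.
  have hpar : ∀ i < t, ∀ k, i < k → (Q i = r ∧ ml r = 0) ∨
      (ml (Q i) ≠ 0 ∧ Function.update vis (b z) t (b (ml (Q i) - 1)) ≠ 0 ∧
      Function.update vis (b z) t (b (ml (Q i) - 1)) < k) := by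
    intro i hi k hk
    rcases Nat.eq_zero_or_pos i with rfl | hi0
    · exact Or.inl ⟨hs.root, hs.free⟩
    · obtain ⟨h1, h2⟩ := hs.queue i hi hi0
      rw [Function.update_of_ne, h2]
      · exact Or.inr ⟨h1, by omega, hk⟩
      · intro e
        rw [e] at h2
        omega
  refine ⟨hbn, by simpa using hs.pos.ne', ?_, ?_, ?_, ?_⟩ <;> intro y hy hvy _ <;>
    by_cases e : y = b z
  · subst e; simpa using hzn
  · rw [Function.update_of_ne e] at hvy ⊢
    exact (hs.pred y hy hvy).1
  · subst e; simp
  · rw [Function.update_of_ne e] at hvy ⊢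
    exact (hs.pred y hy hvy).2.1
  · subst e; simpa using hz
  · rw [Function.update_of_ne e] at hvy ⊢
    exact (hs.pred y hy hvy).2.2.1
  · subst e
    simp only [Function.update_self]
    rw [haz]
    exact hpar h hht t hht
  · rw [Function.update_of_ne e] at hvy ⊢
    rw [Function.update_of_ne e]
    obtain ⟨h4, h5, h6, i, hi, h7⟩ := hs.pred y hy hvy
    have := (hs.reached y hy hvy).1
    rw [h7]
    exact hpar i (by omega) _ hi

end SearchState

/-! ### The change of the potentials -/

/-- The left potentials after an unsuccessful search: the reached vertices lose one unit. -/
def lowerLeft (b ml vis : ℕ → ℕ) (r : ℕ) (u : ℕ → ℕ) (j : ℕ) : ℕ :=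
  u j - ((if j = r then 1 else 0) +
    (if 0 < ml j then 1 else 0) * (if 0 < vis (b (ml j - 1)) then 1 else 0))

/-- The right potentials after an unsuccessful search: the reached vertices gain one unit. -/
def raiseRight (vis v : ℕ → ℕ) (j : ℕ) : ℕ :=
  v j + if 0 < vis j then 1 else 0

theorem lowerLeft_le (b ml vis : ℕ → ℕ) (r : ℕ) (u : ℕ → ℕ) (j : ℕ) :
    lowerLeft b ml vis r u j ≤ u j := Nat.sub_le _ _

/-- An exhausted search has scanned every edge at a reached left vertex. An edge from there to an
unreached right vertex is therefore not tight, and by integrality its slack absorbs one unit. A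
matched edge has both ends reached or neither, so it stays tight. -/
theorem PrimalDual.change {n : ℕ} {a b w nx u v ml mr vis pred Q : ℕ → ℕ} {r t z : ℕ}
    (hd : OverlapData n a b w nx) (hp : PrimalDual n a b w u v ml mr r n)
    (hs : SearchState n a b w u v ml mr r vis pred Q t t z) :
    PrimalDual n a b w (lowerLeft b ml vis r u) (raiseRight vis v) ml mr r n := by
  -- The reached left vertices: the root and the partners of reached right vertices.
  set S : ℕ → Prop := fun x => x = r ∨ (ml x ≠ 0 ∧ vis (b (ml x - 1)) ≠ 0) with hS
  have hlow : ∀ x, lowerLeft b ml vis r u x = u x - if S x then 1 else 0 := by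
    intro x
    simp only [lowerLeft, hS]
    by_cases hx : x = r
    · subst hx; simp [hs.free]
    · by_cases h1 : ml x = 0 <;> by_cases h2 : vis (b (ml x - 1)) = 0 <;>
        simp [hx, h1, h2, Nat.pos_iff_ne_zero]
  have hraise : ∀ y, raiseRight vis v y = v y + if vis y ≠ 0 then 1 else 0 := by
    intro y
    simp only [raiseRight, Nat.pos_iff_ne_zero]
  have hQ : ∀ x < n, S x → ∃ i < t, x = Q i := by
    rintro x hx (rfl | ⟨h1, h2⟩)
    · exact ⟨0, hs.pos, hs.root.symm⟩
    · obtain ⟨z₀, hz₀⟩ := Nat.exists_eq_succ_of_ne_zero h1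
      obtain ⟨h3, h4, -, h5, -⟩ := hp.left x hx z₀ hz₀
      simp only [hz₀, Nat.succ_eq_add_one, Nat.add_sub_cancel] at h2
      obtain ⟨h6, -, h7⟩ := hs.reached _ (hd.b_lt _ h3) h2
      refine ⟨_, h6, ?_⟩
      rw [h7, h5, Nat.add_sub_cancel, h4]
  -- The search enqueues only vertices of positive potential, so the truncated subtraction is a true
  -- one.
  have hpos : ∀ x < n, S x → u x ≠ 0 := by
    intro x hx hSx
    obtain ⟨i, hi, rfl⟩ := hQ x hx hSx
    exact hs.pot i hi
  have hcl : ∀ z < n, S (a z) → u (a z) + v (b z) = w z → vis (b z) ≠ 0 := by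
    intro z hz hSz htt
    obtain ⟨i, hi, e⟩ := hQ _ (hd.a_lt hz) hSz
    refine hs.closed z ?_ htt
    simp only [scanned, Finset.mem_filter, Finset.mem_range]
    exact ⟨hz, Or.inl ⟨i, hi, e⟩⟩
  refine ⟨fun z hz => ?_, fun x hx z hz => ?_, hp.right, fun x hx => ?_, fun y hy hv => ?_⟩
  · rw [hlow, hraise]
    have h1 := hp.cover z hz
    by_cases hSz : S (a z)
    · have h2 := hpos _ (hd.a_lt hz) hSz
      have h3 := hcl z hz hSz
      by_cases h4 : vis (b z) = 0
      · have : u (a z) + v (b z) ≠ w z := fun h => h3 h h4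
        rw [if_pos hSz, if_neg (not_not.2 h4)]
        omega
      · rw [if_pos hSz, if_pos h4]
        omega
    · rw [if_neg hSz]
      omega
  · obtain ⟨h1, h2, h3, h4, h5⟩ := hp.left x hx z hz
    refine ⟨h1, h2, h3, h4, ?_⟩
    rw [hlow, hraise]
    by_cases hv : vis (b z) = 0
    · have : ¬ S x := by
        rintro (rfl | h6)
        · rw [hs.free] at hz; omega
        · rw [hz] at h6; exact h6.2 hv
      simp [this, hv, h5]
    · have hSx : S x := Or.inr ⟨by omega, by rw [hz]; exact hv⟩
      have := hpos x hx hSx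
      rw [if_pos hSx, if_pos hv]
      omega
  · rcases hp.processed x hx with h1 | h1
    · exact Or.inl h1
    · right
      have := lowerLeft_le b ml vis r u x
      omega
  · rw [hraise] at hv
    by_cases hvy : vis y = 0
    · exact hp.matched y hy (by simpa [hvy] using hv)
    · exact (hs.reached y hy hvy).2.1

-- The root itself loses a unit, so a failed search makes progress even if it reaches nothing else.
open Finset in
theorem sum_lowerLeft_lt {n r : ℕ} {b ml vis u : ℕ → ℕ} (hr : r < n) (hu : u r ≠ 0) :
    ∑ j ∈ range n, lowerLeft b ml vis r u j < ∑ j ∈ range n, u j := by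
  refine sum_lt_sum (fun j _ => lowerLeft_le _ _ _ _ _ _) ⟨r, mem_range.2 hr, ?_⟩
  simp only [lowerLeft, if_true]
  omega

/-! ## The matching program

The arrays `0`, …, `10` hold `a`, `b`, `w`, `nx`, `u`, `v`, `ml`, `mr`, `vis`, `pred`, `Q`. -/

namespace MatchingProgram

open RamProg RamExpr

/-- Scan the edge in register `3`. -/
def visit : RamProg := block
  [.assign 17 (arr 1 (reg 3)),
   .ite ((arr 4 (arr 0 (reg 3)) + arr 5 (reg 17)).eq (arr 2 (reg 3)) * (arr 8 (reg 17)).eq (const 0))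
    (block [
      setArr 8 (reg 17) (reg 15),
      setArr 9 (reg 17) (reg 3),
      .assign 18 (arr 7 (reg 17)),
      .ite (reg 18)
        (block [
          .assign 18 (arr 0 (reg 18 - const 1)),
          .ite (arr 4 (reg 18))
            (block [setArr 10 (reg 15) (reg 18), .assign 15 (reg 15 + const 1)])
            (.assign 16 (reg 17 + const 1))])
        (.assign 16 (reg 17 + const 1))])
    .skip]

/-- Move on to the next edge. -/
def advance : RamProg := block
  [.assign 3 (arr 3 (reg 3)),
   .ite ((reg 3).eq (reg 0))
    (block [.assign 14 (reg 14 + const 1), .assign 3 (arr 10 (reg 14))])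
    .skip]

/-- Breadth-first search. -/
def search : RamProg := .loop ((reg 14).lt (reg 15) * (reg 16).eq (const 0)) (.seq visit advance)

/-- The program state during the main loop. -/
structure MainState (n d : ℕ) (a b w nx u v ml mr : ℕ → ℕ) (r : ℕ) (s : RamState) : Prop where
  size : s.reg 0 = n
  budget : s.reg 1 = d
  root : s.reg 13 = r
  c0 : s.col 0 = a
  c1 : s.col 1 = b
  c2 : s.col 2 = w
  c3 : s.col 3 = nx
  c4 : s.col 4 = u
  c5 : s.col 5 = v
  c6 : s.col 6 = ml
  c7 : s.col 7 = mr

variable {n d W : ℕ} {a b w nx u v ml mr vis pred : ℕ → ℕ} {r : ℕ} {s : RamState}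

theorem MainState.set (h : MainState n d a b w nx u v ml mr r s) {i : ℕ} (x : ℕ)
    (h0 : 0 ≠ i) (h1 : 1 ≠ i) (h2 : 2 ≠ i) (h13 : 13 ≠ i) :
    MainState n d a b w nx u v ml mr r (s.set i x) := by
  obtain ⟨_, _, _, _, _, _, _, _, _, _, _⟩ := h
  constructor <;> simp [*]

theorem MainState.setCol (h : MainState n d a b w nx u v ml mr r s) {k : ℕ} (i x : ℕ)
    (hk : 8 ≤ k) (hk' : k < 16) : MainState n d a b w nx u v ml mr r (s.setCol k i x) := by
  obtain ⟨_, _, _, _, _, _, _, _, _, _, _⟩ := h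
  constructor
  case size | budget | root => simpa
  all_goals rw [RamState.col_setCol_of_ne _ _ _ (by omega) hk' (by omega)]; assumption

/-- The search state stored in the machine. -/
def Searching (n : ℕ) (a b w u v ml mr : ℕ → ℕ) (r : ℕ) (s : RamState) : Prop :=
  SearchState n a b w u v ml mr r (s.col 8) (s.col 9) (s.col 10) (s.reg 14) (s.reg 15) (s.reg 3)

/-- The search has been successful. -/
def Found (n : ℕ) (a b w u v ml mr : ℕ → ℕ) (r : ℕ) (s : RamState) : Prop :=
  ∃ y, s.reg 16 = y + 1 ∧ SearchTree n a b w u v ml r (s.col 8) (s.col 9) y ∧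
    s.col 8 y ≤ n + 1 ∧ (mr y = 0 ∨ u (a (mr y - 1)) = 0)

/-- The number of scanned edges. -/
def scanCount (n : ℕ) (a : ℕ → ℕ) (s : RamState) : ℕ :=
  (scanned n a (s.col 10) (s.reg 14) (s.reg 15) (s.reg 3)).card

theorem scanCount_le : scanCount n a s ≤ n :=
  (Finset.card_filter_le _ _).trans (by simp)

/-- Each enqueued vertex is charged to a scanned edge. The current edge is counted only by the
following `advance`, which is why the queue bound is `scanCount + 1` before and `scanCount + 2`
after. This keeps ranks and queue positions within a word. -/
theorem run_visit (hW : 16 ≤ W) (hWn : n + 2 ≤ W) (hd : OverlapData n a b w nx)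
    (hp : PrimalDual n a b w u v ml mr r n) (hs : s.Bdd W)
    (hm : MainState n d a b w nx u v ml mr r s) (hS : Searching n a b w u v ml mr r s)
    (h0 : s.reg 16 = 0) (hlt : s.reg 14 < s.reg 15) (hc : s.reg 15 ≤ scanCount n a s + 1) :
    visit.Run W s 120 fun s' => MainState n d a b w nx u v ml mr r s' ∧ s'.reg 14 ≤ n + 1 ∧
      (Found n a b w u v ml mr r s' ∨
      (s'.reg 16 = 0 ∧ s'.reg 14 < s'.reg 15 ∧ Searching n a b w u v ml mr r s' ∧
        (u (a (s'.reg 3)) + v (b (s'.reg 3)) = w (s'.reg 3) → s'.col 8 (b (s'.reg 3)) ≠ 0) ∧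
        scanCount n a s' = scanCount n a s ∧ s'.reg 15 ≤ scanCount n a s + 2)) := by
  have hcn : scanCount n a s ≤ n := scanCount_le
  obtain ⟨hzn, haz⟩ := hS.edge hlt
  have hbn := hd.b_lt _ hzn
  have hma := hs.col 7 (b (s.reg 3))
  rw [hm.c7] at hma
  refine Run.of_wp_forall hW hs (by decide) (by decide) fun P hP => ?_
  simp [visit, block, hm.c0, hm.c1, hm.c2, hm.c4, hm.c5, hm.c7]
  have htree := hS.searchTree hd hlt (v := v)
  -- Shared by both kinds of success: an unmatched right vertex, or a partner of potential zero.
  have found (s' : RamState) (hm' : MainState n d a b w nx u v ml mr r s')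
      (htt : u (a (s.reg 3)) + v (b (s.reg 3)) = w (s.reg 3)) (hv : s.col 8 (b (s.reg 3)) = 0)
      (h16 : s'.reg 16 = b (s.reg 3) + 1) (h14 : s'.reg 14 = s.reg 14)
      (h8 : s'.col 8 = Function.update (s.col 8) (b (s.reg 3)) (s.reg 15))
      (h9 : s'.col 9 = Function.update (s.col 9) (b (s.reg 3)) (s.reg 3))
      (hu : mr (b (s.reg 3)) = 0 ∨ u (a (mr (b (s.reg 3)) - 1)) = 0) : P s' := by
    refine hP _ ⟨hm', by omega, Or.inl ⟨_, h16, ?_, ?_, hu⟩⟩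
    · rw [h8, h9]; exact htree htt hv
    · rw [h8, Function.update_self]; omega
  refine ⟨by omega, fun htt hv => ⟨by omega, by omega, hma, fun hm0 => ?_, fun hm0 => ?_⟩, fun h => ?_⟩
  · obtain ⟨z₀, hz₀⟩ := Nat.exists_eq_succ_of_ne_zero hm0
    have haz₀ := hd.a_lt (hp.right _ hbn hbn.ne z₀ hz₀).1
    rw [show mr (b (s.reg 3)) - 1 = z₀ by omega]
    refine ⟨by omega, fun hu => ⟨by omega, by omega, hP _ ⟨?_, ?_, Or.inr ⟨?_, ?_, ?_, ?_, ?_, ?_⟩⟩⟩,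
      fun hu => ⟨by omega, found _ ?_ htt hv ?_ ?_ ?_ ?_ ?_⟩⟩
    · exact ((((((hm.set _ (by decide) (by decide) (by decide) (by decide)).setCol _ _
        (by decide) (by decide)).setCol _ _ (by decide) (by decide)).set _ (by decide) (by decide)
        (by decide) (by decide)).set _ (by decide) (by decide) (by decide) (by decide)).setCol _ _
        (by decide) (by decide)).set _ (by decide) (by decide) (by decide) (by decide)
    · simp; omega
    · simpa using h0
    · simp; omega
    · have := hS.push hd hp hlt htt hv hm0 (by rw [show mr (b (s.reg 3)) - 1 = z₀ by omega]; exact hu)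
      simpa [Searching, hz₀] using this
    · have := hS.pos
      simp; omega
    · simp [scanCount, SearchState.scanned_update hlt]
    · simp; omega
    · exact (((((hm.set _ (by decide) (by decide) (by decide) (by decide)).setCol _ _
        (by decide) (by decide)).setCol _ _ (by decide) (by decide)).set _ (by decide) (by decide)
        (by decide) (by decide)).set _ (by decide) (by decide) (by decide) (by decide)).set _
        (by decide) (by decide) (by decide) (by decide)
    · simp
    · simp
    · simp
    · simp
    · right; rw [show mr (b (s.reg 3)) - 1 = z₀ by omega]; exact hu
  · refine ⟨by omega, found _ ?_ htt hv ?_ ?_ ?_ ?_ (Or.inl hm0)⟩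
    · exact ((((hm.set _ (by decide) (by decide) (by decide) (by decide)).setCol _ _
        (by decide) (by decide)).setCol _ _ (by decide) (by decide)).set _ (by decide) (by decide)
        (by decide) (by decide)).set _ (by decide) (by decide) (by decide) (by decide)
    · simp
    · simp
    · simp
    · simp
  · refine hP _ ⟨hm.set _ (by decide) (by decide) (by decide) (by decide), by simp; omega,
      Or.inr ⟨by simpa using h0, by simpa using hlt, by simpa [Searching] using hS, ?_,
      by simp [scanCount], by simp; omega⟩⟩
    simpa using fun htt => h.resolve_left (not_not.2 htt)

theorem run_advance (hW : 16 ≤ W) (hWn : n + 2 ≤ W) (hs : s.Bdd W)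
    (hm : MainState n d a b w nx u v ml mr r s) (hr : s.reg 14 ≤ n + 1)
    {Q : RamState → Prop}
    (hQ : ∀ s', MainState n d a b w nx u v ml mr r s' → s'.reg 16 = s.reg 16 →
      s'.reg 15 = s.reg 15 → s'.col 8 = s.col 8 → s'.col 9 = s.col 9 → s'.col 10 = s.col 10 →
      (nx (s.reg 3) = n → s'.reg 14 = s.reg 14 + 1 ∧ s'.reg 3 = s.col 10 (s.reg 14 + 1)) →
      (nx (s.reg 3) ≠ n → s'.reg 14 = s.reg 14 ∧ s'.reg 3 = nx (s.reg 3)) → Q s') :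
    advance.Run W s 50 Q := by
  have h1 := hs.col 10 (s.reg 14 + 1)
  have h2 := hs.col 3 (s.reg 3)
  rw [hm.c3] at h2
  refine Run.of_wp_forall hW hs (by decide) (by decide) fun P hP => ?_
  simp [advance, block, hm.c3, hm.size]
  refine ⟨h2, fun hn => ⟨by omega, h1, hP _ (hQ _ ?_ ?_ ?_ ?_ ?_ ?_ ?_ ?_)⟩,
    fun hn => hP _ (hQ _ ?_ ?_ ?_ ?_ ?_ ?_ ?_ ?_)⟩
  · exact ((hm.set _ (by decide) (by decide) (by decide) (by decide)).set _ (by decide) (by decide)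
      (by decide) (by decide)).set _ (by decide) (by decide) (by decide) (by decide)
  on_goal 8 => exact hm.set _ (by decide) (by decide) (by decide) (by decide)
  all_goals simp [hn]

theorem run_search (hW : 16 ≤ W) (hWn : n + 2 ≤ W) (hd : OverlapData n a b w nx)
    (hp : PrimalDual n a b w u v ml mr r n) (hs : s.Bdd W)
    (hm : MainState n d a b w nx u v ml mr r s) (hS : Searching n a b w u v ml mr r s)
    (h0 : s.reg 16 = 0) (hc : s.reg 15 ≤ scanCount n a s + 1) :
    search.Run W s (200 * (n + 1)) fun s' => MainState n d a b w nx u v ml mr r s' ∧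
      (Found n a b w u v ml mr r s' ∨ (s'.reg 16 = 0 ∧ s'.reg 14 = s'.reg 15 ∧
        Searching n a b w u v ml mr r s')) := by
  refine (Run.loop hW (by decide) (fun s' => MainState n d a b w nx u v ml mr r s' ∧
    (Found n a b w u v ml mr r s' ∨ (s'.reg 16 = 0 ∧ s'.reg 15 ≤ scanCount n a s' + 1 ∧
        Searching n a b w u v ml mr r s')))
    -- The extra `1` lets the measure drop to `0` when a path is found, however many edges are left.
    -- The round time `170` is `120` for `visit` plus `50` for `advance`.
    (fun s' => if s'.reg 16 = 0 then 1 + (n - scanCount n a s') else 0) 170 ?_ hs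
    ⟨hm, Or.inr ⟨h0, hc, hS⟩⟩).mono ?_ ?_
  · rintro s hs ⟨hm, hI⟩ he
    simp at he
    obtain ⟨hlt, h0⟩ := he
    obtain ⟨y, hy, -⟩ | ⟨-, hc, hS⟩ := hI
    · omega
    refine (Run.seq (run_visit hW hWn hd hp hs hm hS h0 hlt hc) (T₂ := 50) ?_).mono (by norm_num)
      fun _ _ => id
    rintro s₁ hs₁ ⟨hm₁, h14, h⟩
    refine run_advance hW hWn hs₁ hm₁ h14 ?_
    intro s₂ hm₂ e16 e15 e8 e9 e10 eY eN
    -- After a success `advance` still runs, but it changes only registers that `Found` does not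
    -- mention.
    rcases h with ⟨y, hy, ht, hv, hu⟩ | ⟨h16, hlt₁, hS₁, htt, hcard, h15⟩
    · refine ⟨⟨hm₂, Or.inl ⟨y, by omega, by rw [e8, e9]; exact ht, by rw [e8]; exact hv, hu⟩⟩, ?_⟩
      rw [if_neg (by omega), if_pos h0]
      omega
    · have hS₂ : Searching n a b w u v ml mr r s₂ := by
        rw [Searching, e8, e9, e10, e15]
        by_cases hn : nx (s₁.reg 3) = n
        · rw [(eY hn).1, (eY hn).2]
          exact hS₁.next_vertex hd hlt₁ htt hn
        · rw [(eN hn).1, (eN hn).2]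
          exact hS₁.next_edge hd hlt₁ htt hn
      have hcard₂ : scanCount n a s₁ < scanCount n a s₂ := by
        have := hS₁.card_scanned_next hd hlt₁
        rw [scanCount, scanCount, e10, e15]
        by_cases hn : nx (s₁.reg 3) = n
        · rw [(eY hn).1, (eY hn).2]
          rwa [if_pos hn] at this
        · rw [(eN hn).1, (eN hn).2]
          rwa [if_neg hn] at this
      have hle : scanCount n a s₂ ≤ n := scanCount_le
      refine ⟨⟨hm₂, Or.inr ⟨by omega, by omega, hS₂⟩⟩, ?_⟩
      rw [if_pos (by omega), if_pos h0]
      omega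
  · rw [if_pos h0]
    have : 1 + (n - scanCount n a s) ≤ n + 1 := by omega
    calc _ ≤ (n + 1) * (7 + 1 + 170) + (7 + 1) := Nat.add_le_add_right (Nat.mul_le_mul_right _ this) _
      _ ≤ _ := by omega
  · rintro s' - ⟨⟨hm', hI⟩, he⟩
    refine ⟨hm', ?_⟩
    rcases hI with h | ⟨h16, hc', hS'⟩
    · exact Or.inl h
    · refine Or.inr ⟨h16, ?_, hS'⟩
      simp [h16] at he
      exact le_antisymm hS'.le he

end MatchingProgram

/-! ### Augmentation, change of the potentials, and the main loop -/

namespace MatchingProgram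

open RamProg RamExpr

/-- One step of the augmentation; register `17` holds the current vertex. -/
def augmentStep : RamProg := block
  [.assign 3 (arr 9 (reg 17)),
   .assign 5 (arr 0 (reg 3)),
   .assign 18 (arr 6 (reg 5)),
   setArr 6 (reg 5) (reg 3 + const 1),
   setArr 7 (reg 17) (reg 3 + const 1),
   .ite (reg 18) (.assign 17 (arr 1 (reg 18 - const 1))) .skip]

/-- Preparation of the augmentation. -/
def augmentInit : RamProg := block
  [.assign 17 (reg 16 - const 1),
   .assign 18 (arr 7 (reg 17)),
   .ite (reg 18) (setArr 6 (arr 0 (reg 18 - const 1)) (const 0)) .skip,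
   .assign 18 (const 1)]

/-- Augment along the path that has been found. -/
def augment : RamProg := .seq augmentInit
  (.seq (.loop (reg 18) augmentStep) (.assign 13 (reg 13 + const 1)))

variable {n d W : ℕ} {a b w nx u v ml mr vis pred : ℕ → ℕ} {r : ℕ} {s : RamState}

theorem MainState.matching {ml' mr' : ℕ → ℕ} {s' : RamState}
    (h : MainState n d a b w nx u v ml mr r s)
    (hreg : ∀ i ∈ [0, 1, 13], s'.reg i = s.reg i) (hcol : ∀ i < 6, s'.col i = s.col i)
    (h6 : s'.col 6 = ml') (h7 : s'.col 7 = mr') : MainState n d a b w nx u v ml' mr' r s' where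
  size := (hreg 0 (by simp)).trans h.size
  budget := (hreg 1 (by simp)).trans h.budget
  root := (hreg 13 (by simp)).trans h.root
  c0 := (hcol 0 (by omega)).trans h.c0
  c1 := (hcol 1 (by omega)).trans h.c1
  c2 := (hcol 2 (by omega)).trans h.c2
  c3 := (hcol 3 (by omega)).trans h.c3
  c4 := (hcol 4 (by omega)).trans h.c4
  c5 := (hcol 5 (by omega)).trans h.c5
  c6 := h6
  c7 := h7

/-- The state during the augmentation. -/
def Augmenting (n d : ℕ) (a b w nx u v : ℕ → ℕ) (r : ℕ) (vis pred : ℕ → ℕ) (s : RamState) :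
    Prop :=
  ∃ ml mr, MainState n d a b w nx u v ml mr r s ∧ s.col 8 = vis ∧ s.col 9 = pred ∧
    ((s.reg 18 ≠ 0 ∧ PrimalDual n a b w u v ml mr r (s.reg 17) ∧
        SearchTree n a b w u v ml r vis pred (s.reg 17)) ∨
      (s.reg 18 = 0 ∧ PrimalDual n a b w u v ml mr r n ∧ ml r ≠ 0))

/-- The rank of the current vertex decreases along the path to the root. Register `18` keeps the old
partner of the left vertex, and its being `0` shows that the root has been matched. -/
theorem run_augmentStep (hW : 16 ≤ W) (hWn : n + 2 ≤ W) (hd : OverlapData n a b w nx)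
    (hs : s.Bdd W) (h : Augmenting n d a b w nx u v r vis pred s) (h18 : s.reg 18 ≠ 0) :
    augmentStep.Run W s 80 fun s' => Augmenting n d a b w nx u v r vis pred s' ∧
      (if s'.reg 18 = 0 then 0 else vis (s'.reg 17)) <
        (if s.reg 18 = 0 then 0 else vis (s.reg 17)) := by
  obtain ⟨ml, mr, hm, h8, h9, ⟨-, hp, ht⟩ | ⟨h0, -⟩⟩ := h
  swap
  · exact absurd h0 h18
  have hpn := ht.pred_lt _ ht.cur_lt ht.vis_cur le_rfl
  have han := hd.a_lt hpn
  have hB := hs.col 6 (a (pred (s.reg 17)))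
  rw [hm.c6] at hB
  have hv0 := ht.vis_cur
  refine Run.of_wp_forall hW hs (by decide) (by decide) fun P hP => ?_
  simp [augmentStep, block, hm.c0, hm.c1, hm.c6, h9]
  refine ⟨by omega, by omega, hB, by omega, fun h0 => ⟨?_, hP _ ⟨⟨_, _, hm.matching ?_ ?_ rfl rfl,
    ?_, ?_, Or.inl ⟨?_, ?_, ?_⟩⟩, ?_⟩⟩, fun h0 => hP _ ⟨⟨_, _, hm.matching ?_ ?_ rfl rfl,
    ?_, ?_, Or.inr ⟨?_, ?_, ?_⟩⟩, ?_⟩⟩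
  · have := (hp.augment_step hd ht h0).2.2.cur_lt
    omega
  · simp
  · intro i hi; interval_cases i <;> simp
  · simpa using h8
  · simpa using h9
  · simpa using h0
  · simpa [hm.c6, hm.c7] using (hp.augment_step hd ht h0).2.1
  · simpa [hm.c6, hm.c7] using (hp.augment_step hd ht h0).2.2
  · simpa [h0, h18] using (hp.augment_step hd ht h0).1
  · simp
  · intro i hi; interval_cases i <;> simp
  · simpa using h8
  · simpa using h9
  · simpa using h0
  · simpa [hm.c6, hm.c7] using (hp.augment_last hd ht h0).2
  · simp [hm.c6, (hp.augment_last hd ht h0).1]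
  · simpa [h0, h18, Nat.pos_iff_ne_zero] using hv0

/-- If the end vertex is matched, its partner has potential zero and may be released. The stale
entry of `mr` remains, since `cur` counts as unmatched. Register `18` is set to `1` so that the loop
is entered. -/
theorem run_augmentInit (hW : 16 ≤ W) (hWn : n + 2 ≤ W) (hs : s.Bdd W)
    (hp : PrimalDual n a b w u v ml mr r n)
    (hm : MainState n d a b w nx u v ml mr r s) (hf : Found n a b w u v ml mr r s) :
    augmentInit.Run W s 40 fun s' => ∃ vis pred, Augmenting n d a b w nx u v r vis pred s' ∧
      vis (s'.reg 17) ≤ n + 1 := by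
  obtain ⟨y, h16, ht, hv, hu⟩ := hf
  have hB := hs.col 7 y
  rw [hm.c7] at hB
  have hyn := ht.cur_lt
  refine Run.of_wp_forall hW hs (by decide) (by decide) fun P hP => ?_
  simp [augmentInit, block, hm.c0, hm.c7, h16]
  refine ⟨by omega, hB, fun h0 => ⟨by omega, hP _ ⟨s.col 8, s.col 9, ⟨_, _, hm.matching ?_ ?_ rfl
    rfl, by simp, by simp, Or.inl ⟨by simp, ?_, ?_⟩⟩, by simpa using hv⟩⟩, fun h0 => ⟨by omega, hP _ ⟨s.col 8, s.col 9,
    ⟨_, _, hm.matching ?_ ?_ rfl rfl, by simp, by simp, Or.inl ⟨by simp, ?_, ?_⟩⟩,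
    by simpa using hv⟩⟩⟩
  · simp
  · intro i hi; interval_cases i <;> simp
  · simpa [hm.c6, hm.c7] using (hp.drop ht h0 (hu.resolve_left h0)).1
  · simpa [hm.c6, hm.c7] using (hp.drop ht h0 (hu.resolve_left h0)).2
  · simp
  · intro i hi; interval_cases i <;> simp
  · simpa [hm.c6, hm.c7] using hp.of_free h0
  · simpa [hm.c6, hm.c7] using ht

theorem PrimalDual.succ (h : PrimalDual n a b w u v ml mr r n) (hr : ml r ≠ 0 ∨ u r = 0) :
    PrimalDual n a b w u v ml mr (r + 1) n :=
  ⟨h.cover, h.left, h.right, fun x hx => (Nat.lt_succ_iff_lt_or_eq.1 hx).elim (h.processed x)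
    fun e => e ▸ hr, h.matched⟩

theorem run_augment (hW : 16 ≤ W) (hWn : n + 2 ≤ W) (hd : OverlapData n a b w nx) (hs : s.Bdd W)
    (hp : PrimalDual n a b w u v ml mr r n) (hrn : r < n)
    (hm : MainState n d a b w nx u v ml mr r s) (hf : Found n a b w u v ml mr r s) :
    augment.Run W s (200 * (n + 1)) fun s' => ∃ ml mr,
      MainState n d a b w nx u v ml mr (r + 1) s' ∧ PrimalDual n a b w u v ml mr (r + 1) n := by
  refine (Run.seq (run_augmentInit hW hWn hs hp hm hf)
    (T₂ := (n + 1) * 82 + 2 + 4) ?_).mono (by omega) fun _ _ => id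
  rintro s₁ hs₁ ⟨vis, pred, hA, hvis⟩
  refine Run.seq (T₁ := (n + 1) * 82 + 2) (T₂ := 4) ((Run.loop (e := reg 18) hW (by decide) _ _ 80
    (fun s hs hI he => run_augmentStep hW hWn hd hs hI he) hs₁ hA).mono ?_ fun _ _ => id) ?_
  · refine Nat.add_le_add_right (Nat.mul_le_mul_right _ ?_) _
    split_ifs <;> omega
  · rintro s₂ hs₂ ⟨⟨ml', mr', hm', -, -, h⟩, h0⟩
    rcases h with ⟨h1, -⟩ | ⟨-, hp', hml⟩
    · exact absurd h0 h1
    refine Run.of_wp_forall hW hs₂ (by decide) (by decide) fun P hP => ?_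
    simp [hm'.root]
    refine ⟨by omega, hP _ ⟨ml', mr', ?_, PrimalDual.succ hp' (Or.inl hml)⟩⟩
    obtain ⟨_, _, _, _, _, _, _, _, _, _, _⟩ := hm'
    constructor <;> simp [*]

/-- Change the potentials of the vertex in register `4`. -/
def changeStep : RamProg := block
  [.assign 18 (arr 6 (reg 4)),
   setArr 4 (reg 4) (arr 4 (reg 4) - ((reg 4).eq (reg 13) +
     (const 0).lt (reg 18) * (const 0).lt (arr 8 (arr 1 (reg 18 - const 1))))),
   setArr 5 (reg 4) (arr 5 (reg 4) + (const 0).lt (arr 8 (reg 4))),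
   .assign 4 (reg 4 + const 1)]

/-- Change the potentials. -/
def change : RamProg := .seq (.assign 4 (const 0)) (.loop ((reg 4).lt (reg 0)) changeStep)

/-- One step of an in-place pass over an array: the entries before `j` are new, the others still
old. -/
theorem update_prefix {f g : ℕ → ℕ} {j : ℕ} :
    Function.update (fun i => if i < j then f i else g i) j (f j) =
      fun i => if i < j + 1 then f i else g i := by
  funext i
  rcases lt_trichotomy i j with h | rfl | h
  · rw [Function.update_of_ne h.ne, if_pos h, if_pos (by omega)]
  · simp
  · rw [Function.update_of_ne h.ne', if_neg (by omega), if_neg (by omega)]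

/-- The new potential of a vertex depends on its own old potential, the matching and the marks only,
so one pass in place suffices. The bound on `v` leaves room for the added unit. -/
theorem run_change (hW : 16 ≤ W) (hWn : n + 2 ≤ W) (hs : s.Bdd W)
    (hv : ∀ y < n, v y ≤ n) (hm : MainState n d a b w nx u v ml mr r s) :
    change.Run W s (100 * (n + 1)) fun s' => ∃ u' v',
      MainState n d a b w nx u' v' ml mr r s' ∧
      (∀ i < n, u' i = lowerLeft b ml (s.col 8) r u i) ∧ ∀ i < n, v' i = raiseRight (s.col 8) v i := by
  set vis := s.col 8 with hvis
  have hu : ∀ i, u i ≤ W := fun i => by have := hs.col 4 i; rwa [hm.c4] at this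
  have hml : ∀ i, ml i ≤ W := fun i => by have := hs.col 6 i; rwa [hm.c6] at this
  refine (Run.seq (T₁ := 2) (T₂ := n * 94 + 4) (P := fun s' =>
    MainState n d a b w nx u v ml mr r s' ∧ s'.col 8 = vis ∧ s'.reg 4 = 0) ?_ ?_).mono
    (by omega) fun _ _ => id
  · refine Run.of_wp_forall hW hs (by decide) (by decide) fun P hP => ?_
    simp
    exact hP _ ⟨hm.set _ (by decide) (by decide) (by decide) (by decide), by simp [hvis], by simp⟩
  rintro s₁ hs₁ ⟨hm₁, h8, h4⟩
  refine (Run.loop hW (by decide) (fun s' => s'.reg 4 ≤ n ∧ s'.col 8 = vis ∧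
    MainState n d a b w nx
      (fun i => if i < s'.reg 4 then lowerLeft b ml vis r u i else u i)
      (fun i => if i < s'.reg 4 then raiseRight vis v i else v i) ml mr r s')
    (fun s' => n - s'.reg 4) 90 ?_ hs₁ ⟨by omega, h8, ?_⟩).mono ?_ ?_
  · rintro s hs ⟨hj, h8, hm⟩ he
    simp [hm.size] at he
    refine Run.of_wp_forall hW hs (by decide) (by decide) fun P hP => ?_
    simp [changeStep, block, hm.c6, hm.c4, hm.c5, hm.c1, h8, hm.root]
    have e1 : u (s.reg 4) - (flag (s.reg 4 = r) + flag (0 < ml (s.reg 4)) *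
        flag (0 < vis (b (ml (s.reg 4) - 1)))) = lowerLeft b ml vis r u (s.reg 4) := by
      simp only [lowerLeft, flag_eq_ite]
    have e2 : v (s.reg 4) + flag (0 < vis (s.reg 4)) = raiseRight vis v (s.reg 4) := by
      simp only [raiseRight, flag_eq_ite]
    have h1 := hu (s.reg 4)
    have h2 := hv _ he
    have h3 := flag_le_one (0 < vis (s.reg 4))
    refine ⟨hml _, by omega, by omega, by omega, hP _ ⟨⟨?_, ?_, ?_⟩, ?_⟩⟩
    · simp; omega
    · simpa using h8
    · constructor
      case c4 => simp [hm.c4, e1, update_prefix]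
      case c5 => simp [hm.c5, e2, update_prefix]
      all_goals obtain ⟨_, _, _, _, _, _, _, _, _, _, _⟩ := hm; simp [*]
    · simp; omega
  · simpa [h4] using hm₁
  · change (n - s₁.reg 4) * (3 + 1 + 90) + (3 + 1) ≤ n * 94 + 4
    rw [h4]; omega
  · rintro s' - ⟨⟨hj, h8, hm⟩, he⟩
    simp [hm.size] at he
    obtain e : s'.reg 4 = n := by omega
    rw [e] at hm
    exact ⟨_, _, hm, fun i hi => if_pos hi, fun i hi => if_pos hi⟩

/-- Clear the marks of the previous search. -/
def clear : RamProg := .seq (.assign 4 (const 0)) (.loop ((reg 4).lt (reg 0))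
  (block [setArr 8 (reg 4) (const 0), .assign 4 (reg 4 + const 1)]))

/-- Start the search. -/
def searchInit : RamProg := block
  [.assign 14 (const 0), .assign 15 (const 1), setArr 10 (const 0) (reg 13),
   .assign 3 (reg 13), .assign 16 (const 0)]

/-- One round of the main loop. -/
def round : RamProg := .ite ((arr 6 (reg 13)).eq (const 0) * (const 0).lt (arr 4 (reg 13)))
  (.seq clear (.seq searchInit (.seq search (.ite (reg 16) augment change))))
  (.assign 13 (reg 13 + const 1))

theorem run_clear (hW : 16 ≤ W) (hWn : n + 2 ≤ W) (hs : s.Bdd W)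
    (hm : MainState n d a b w nx u v ml mr r s) :
    clear.Run W s (100 * (n + 1)) fun s' =>
      MainState n d a b w nx u v ml mr r s' ∧ ∀ y < n, s'.col 8 y = 0 := by
  refine (Run.seq (T₁ := 2) (T₂ := n * 34 + 4) (P := fun s' =>
    MainState n d a b w nx u v ml mr r s' ∧ s'.reg 4 = 0) ?_ ?_).mono
    (by omega) fun _ _ => id
  · refine Run.of_wp_forall hW hs (by decide) (by decide) fun P hP => ?_
    simp
    exact hP _ ⟨hm.set _ (by decide) (by decide) (by decide) (by decide), by simp⟩
  rintro s₁ hs₁ ⟨hm₁, h4⟩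
  refine (Run.loop hW (by decide) (fun s' => s'.reg 4 ≤ n ∧
    MainState n d a b w nx u v ml mr r s' ∧ ∀ y < s'.reg 4, s'.col 8 y = 0)
    (fun s' => n - s'.reg 4) 30 ?_ hs₁ ⟨by omega, hm₁, by omega⟩).mono ?_ ?_
  · rintro s hs ⟨hj, hm, h8⟩ he
    simp [hm.size] at he
    refine Run.of_wp_forall hW hs (by decide) (by decide) fun P hP => ?_
    simp [block]
    refine ⟨by omega, hP _ ⟨⟨by simp; omega, (hm.setCol _ _ (by decide) (by decide)).set _
      (by decide) (by decide) (by decide) (by decide), fun y hy => ?_⟩, by simp; omega⟩⟩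
    simp at hy ⊢
    by_cases e : y = s.reg 4
    · subst e; simp
    · rw [Function.update_of_ne e]; exact h8 y (by omega)
  · change (n - s₁.reg 4) * (3 + 1 + 30) + (3 + 1) ≤ n * 34 + 4
    rw [h4]; omega
  · rintro s' - ⟨⟨hj, hm, h8⟩, he⟩
    simp [hm.size] at he
    exact ⟨hm, fun y hy => h8 y (by omega)⟩

/-- The invariant of the main loop. -/
def MainInv (n d : ℕ) (a b w nx : ℕ → ℕ) (s : RamState) : Prop :=
  ∃ u v ml mr r, r ≤ n ∧ MainState n d a b w nx u v ml mr r s ∧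
    PrimalDual n a b w u v ml mr r n ∧ ∀ x < n, a x ≠ x → u x = 0

open Finset in
/-- The number of rounds to go is at most this. -/
def potential (n : ℕ) (s : RamState) : ℕ := ∑ j ∈ range n, s.col 4 j + (n - s.reg 13)

/-- Skipping a finished vertex or augmenting advances `r` and leaves `u` alone; a failed search
keeps `r` and lowers the sum of `u`. A round contains at most one search and one augmentation or
dual change, each linear in `n`. -/
theorem run_round (hW : 16 ≤ W) (hWn : n + 2 ≤ W) (hd : OverlapData n a b w nx) (hs : s.Bdd W)
    (hI : MainInv n d a b w nx s) (hlt : s.reg 13 < n) :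
    round.Run W s (700 * (n + 1)) fun s' =>
      MainInv n d a b w nx s' ∧ potential n s' < potential n s := by
  obtain ⟨u, v, ml, mr, r, hrn, hm, hp, hrep⟩ := hI
  rw [hm.root] at hlt
  refine (Run.ite (T := 600 * (n + 1)) hW hs (by decide) ?_ ?_).mono
    (T := _ + _ + 600 * (n + 1)) (show 22 + 600 * (n + 1) ≤ _ by omega) fun _ _ => id
  swap
  · intro h0
    simp [hm.c6, hm.c4, hm.root] at h0
    have h1 : ml r ≠ 0 ∨ u r = 0 := h0
    refine Run.of_wp_forall hW hs (by decide) (show 4 ≤ _ by omega) fun P hP => ?_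
    simp [hm.root]
    refine ⟨by omega, hP _ ⟨⟨u, v, ml, mr, r + 1, hlt, ?_, PrimalDual.succ hp h1, hrep⟩, ?_⟩⟩
    · obtain ⟨_, _, _, _, _, _, _, _, _, _, _⟩ := hm
      constructor <;> simp [*]
    · simp [potential, hm.root]
      omega
  · intro h0
    simp [hm.c6, hm.c4, hm.root] at h0
    obtain ⟨h1, h2⟩ := h0
    have har : a r = r := by
      by_contra h
      have := hrep r hlt h
      omega
    refine Run.mono (T := 100 * (n + 1) + (20 + (200 * (n + 1) + (2 + 200 * (n + 1)))))
      (Run.seq (run_clear hW hWn hs hm) ?_) (by omega) fun _ _ => id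
    rintro s₁ hs₁ ⟨hm₁, hvis⟩
    refine Run.seq (P := fun s' => MainState n d a b w nx u v ml mr r s' ∧
      Searching n a b w u v ml mr r s' ∧ s'.reg 16 = 0 ∧ s'.reg 15 = 1) ?_ ?_
    · refine Run.of_wp_forall hW hs₁ (by decide) (by decide) fun P hP => ?_
      simp [searchInit, block, hm₁.root]
      refine ⟨by omega, by omega, hP _ ⟨?_, ?_, by simp, by simp⟩⟩
      · exact ((((hm₁.set _ (by decide) (by decide) (by decide) (by decide)).set _ (by decide)
          (by decide) (by decide) (by decide)).setCol _ _ (by decide) (by decide)).set _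
          (by decide) (by decide) (by decide) (by decide)).set _ (by decide) (by decide)
          (by decide) (by decide)
      · simp [Searching]
        exact SearchState.init hlt har hd.a_le h2 h1 (by simp) hvis
    rintro s₂ hs₂ ⟨hm₂, hS₂, h16, h15⟩
    refine Run.seq (run_search hW hWn hd hp hs₂ hm₂ hS₂ h16 (by omega)) ?_
    rintro s₃ hs₃ ⟨hm₃, h⟩
    refine Run.ite hW hs₃ (by decide) ?_ ?_
    · intro hne
      simp at hne
      rcases h with hf | ⟨h0, -⟩
      swap
      · exact absurd h0 hne
      refine (run_augment hW hWn hd hs₃ hp hlt hm₃ hf).mono le_rfl ?_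
      rintro s' - ⟨ml', mr', hm', hp'⟩
      refine ⟨⟨u, v, ml', mr', r + 1, hlt, hm', hp', hrep⟩, ?_⟩
      simp only [potential, hm'.c4, hm'.root, hm.c4, hm.root]
      omega
    · intro he
      simp at he
      rcases h with ⟨y, hy, -⟩ | ⟨-, htt, hS₃⟩
      · omega
      refine (run_change hW hWn hs₃ (fun y hy => hp.v_le hd hy) hm₃).mono (by omega) ?_
      rintro s' - ⟨u', v', hm', hu', hv'⟩
      rw [Searching, htt] at hS₃
      refine ⟨⟨u', v', ml, mr, r, hrn, hm', (hp.change hd hS₃).congr hd hrn hu' hv', ?_⟩, ?_⟩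
      · intro x hx hax
        have := lowerLeft_le b ml (s₃.col 8) r u x
        rw [hu' x hx]
        have := hrep x hx hax
        omega
      · have := sum_lowerLeft_lt (b := b) (ml := ml) (vis := s₃.col 8) hlt h2
        simp only [potential, hm'.c4, hm'.root, hm.c4, hm.root]
        rw [Finset.sum_congr rfl fun j hj => hu' j (Finset.mem_range.1 hj)]
        exact Nat.add_lt_add_right this _

/-- The main loop. -/
def mainLoop : RamProg := .loop ((reg 13).lt (reg 0)) round

/-- Add up the potentials and compare the sum with the budget. -/
def answer : RamProg := .seq (block [.assign 4 (const 0), .assign 19 (const 0)])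
  (.seq (.loop ((reg 4).lt (reg 0)) (block
    [.assign 19 (reg 19 + (arr 4 (reg 4) + arr 5 (reg 4))), .assign 4 (reg 4 + const 1)]))
  (.assign 0 ((reg 0).lt (reg 19 + reg 1 + const 1))))

open Finset in
theorem run_mainLoop (hW : 16 ≤ W) (hWn : n + 2 ≤ W) (hd : OverlapData n a b w nx)
    (hs : s.Bdd W) (hI : MainInv n d a b w nx s) (hu : ∑ j ∈ range n, s.col 4 j ≤ n)
    (h13 : s.reg 13 = 0) :
    mainLoop.Run W s (1600 * (n + 1) ^ 2) fun s' => ∃ u v ml mr,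
      MainState n d a b w nx u v ml mr n s' ∧ PrimalDual n a b w u v ml mr n n := by
  refine (Run.loop hW (by decide) (MainInv n d a b w nx) (potential n) (700 * (n + 1))
    ?_ hs hI).mono ?_ ?_
  · intro s hs hI he
    refine run_round hW hWn hd hs hI ?_
    obtain ⟨u, v, ml, mr, r, hrn, hm, -⟩ := hI
    simpa [hm.size] using he
  -- One `n` for the initial sum of `u`, one for the left vertices to be processed.
  · have h1 : potential n s ≤ 2 * n := by
      simp only [potential, h13]; omega
    calc _ ≤ 2 * n * (3 + 1 + 700 * (n + 1)) + (3 + 1) :=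
          Nat.add_le_add_right (Nat.mul_le_mul_right _ h1) _
      _ ≤ _ := by nlinarith
  · rintro s' - ⟨⟨u, v, ml, mr, r, hrn, hm, hp, -⟩, he⟩
    simp [hm.size, hm.root] at he
    obtain rfl : r = n := by omega
    exact ⟨u, v, ml, mr, hm, hp⟩

open Finset in
theorem run_answer (hW : 16 ≤ W) (hWn : n + 2 ≤ W) (hs : s.Bdd W) {m : ℕ}
    (hm : MainState n d a b w nx u v ml mr m s) (hsum : ∑ j ∈ range n, (u j + v j) ≤ n) :
    answer.Run W s (100 * (n + 1)) fun s' =>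
      (n ≤ ∑ j ∈ range n, (u j + v j) + d → s'.reg 0 = 1) ∧
      (¬ n ≤ ∑ j ∈ range n, (u j + v j) + d → s'.reg 0 = 0) := by
  refine (Run.seq (T₁ := 4) (T₂ := n * 54 + 4 + 10) (P := fun s' =>
    MainState n d a b w nx u v ml mr m s' ∧ s'.reg 4 = 0 ∧ s'.reg 19 = 0) ?_ ?_).mono
    (by omega) fun _ _ => id
  · refine Run.of_wp_forall hW hs (by decide) (by decide) fun P hP => ?_
    simp [block]
    exact hP _ ⟨(hm.set _ (by decide) (by decide) (by decide) (by decide)).set _ (by decide)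
      (by decide) (by decide) (by decide), by simp, by simp⟩
  rintro s₁ hs₁ ⟨hm₁, h4, h19⟩
  refine Run.seq (P := fun s' => MainState n d a b w nx u v ml mr m s' ∧
    s'.reg 19 = ∑ j ∈ range n, (u j + v j)) ((Run.loop hW (by decide)
    (fun s' => MainState n d a b w nx u v ml mr m s' ∧ s'.reg 4 ≤ n ∧
    s'.reg 19 = ∑ j ∈ range (s'.reg 4), (u j + v j)) (fun s' => n - s'.reg 4) 50 ?_ hs₁
    ⟨hm₁, by omega, by simp [h4, h19]⟩).mono ?_ ?_) ?_
  · rintro s hs ⟨hm, hj, h19⟩ he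
    simp [hm.size] at he
    refine Run.of_wp_forall hW hs (by decide) (by decide) fun P hP => ?_
    simp [block, hm.c4, hm.c5, h19]
    have hle : ∑ j ∈ range (s.reg 4), (u j + v j) + (u (s.reg 4) + v (s.reg 4)) ≤ n := by
      rw [← sum_range_succ]
      exact (sum_le_sum_of_subset (range_mono he)).trans hsum
    refine ⟨by omega, by omega, hP _ ⟨⟨(hm.set _ (by decide) (by decide) (by decide)
      (by decide)).set _ (by decide) (by decide) (by decide) (by decide), by simp; omega, ?_⟩,
      by simp; omega⟩⟩
    simp [sum_range_succ]
  · change (n - s₁.reg 4) * (3 + 1 + 50) + (3 + 1) ≤ n * 54 + 4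
    rw [h4]; omega
  · rintro s' - ⟨⟨hm, hj, h19⟩, he⟩
    simp [hm.size] at he
    obtain e : s'.reg 4 = n := by omega
    exact ⟨hm, by rw [h19, e]⟩
  · rintro s₂ hs₂ ⟨hm₂, h19⟩
    refine Run.of_wp_forall hW hs₂ (by decide) (by decide) fun P hP => ?_
    simp [hm₂.size, hm₂.budget, h19]
    have := flag_le_one (n ≤ ∑ j ∈ range n, (u j + v j) + d)
    refine ⟨by omega, hP _ ⟨fun h => ?_, fun h => ?_⟩⟩
    · simpa using flag_of_true (by omega)
    · simpa using by omega

end MatchingProgram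

/-! ### Branch-free minima and counts, and equivalence relations given by labels -/

theorem flag_mul_flag (p q : Prop) : flag p * flag q = flag (p ∧ q) := by
  classical by_cases hp : p <;> by_cases hq : q <;> simp [flag_eq_ite, hp, hq]

theorem flag_inj {p q : Prop} : flag p = flag q ↔ (p ↔ q) := by
  classical by_cases hp : p <;> by_cases hq : q <;> simp [flag_eq_ite, hp, hq]

/-- `x` is the least `j` with `m ≤ j < n` and `p j`, or `n` if there is none. -/
structure LeastFrom (p : ℕ → Prop) (n m x : ℕ) : Prop where
  le : x ≤ n
  ge : m ≤ x
  min : ∀ j, m ≤ j → j < n → p j → x ≤ j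
  prop : x < n → p x

namespace LeastFrom

variable {p : ℕ → Prop} {n m x : ℕ}

theorem self : LeastFrom p n n n :=
  ⟨le_rfl, le_rfl, fun _ h _ _ => h, fun h => absurd h (lt_irrefl _)⟩

/-- In a descending scan the newest hit is the least. As `m ≤ x`, the new value is exactly `m` or
`x`, depending on the flag. -/
theorem pred (h : LeastFrom p n (m + 1) x) : LeastFrom p n m (x - flag (p m) * (x - m)) := by
  have h1 := h.le
  have h2 := h.ge
  by_cases hp : p m
  · rw [flag_of_true hp, show x - 1 * (x - m) = m by omega]
    exact ⟨by omega, le_rfl, fun _ hj _ _ => hj, fun _ => hp⟩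
  · rw [flag_eq_zero.2 hp, Nat.zero_mul, Nat.sub_zero]
    refine ⟨h1, by omega, fun j hj hjn hpj => ?_, h.prop⟩
    rcases Nat.eq_or_lt_of_le hj with rfl | hj
    · exact absurd hpj hp
    · exact h.min j hj hjn hpj

end LeastFrom

open Finset in
/-- The number of `j` with `m ≤ j < n` and `p j`. -/
noncomputable def countFrom (p : ℕ → Prop) (n m : ℕ) : ℕ := ∑ j ∈ Ico m n, flag (p j)

theorem countFrom_self (p : ℕ → Prop) (n : ℕ) : countFrom p n n = 0 := by simp [countFrom]

theorem countFrom_pred {p : ℕ → Prop} {n m : ℕ} (h : m < n) :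
    countFrom p n m = countFrom p n (m + 1) + flag (p m) := by
  rw [countFrom, Finset.sum_eq_sum_Ico_succ_bot h, add_comm]; rfl

open Finset in
theorem countFrom_zero (p : ℕ → Prop) [DecidablePred p] (n : ℕ) :
    countFrom p n 0 = #{j ∈ range n | p j} := by
  rw [countFrom, card_filter, range_eq_Ico]
  exact sum_congr rfl fun _ _ => flag_eq_ite _

theorem countFrom_le (p : ℕ → Prop) (n m : ℕ) : countFrom p n m ≤ n := by
  calc countFrom p n m ≤ ∑ j ∈ Finset.Ico m n, 1 :=
        Finset.sum_le_sum fun _ _ => flag_le_one _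
    _ ≤ n := by simp

/-- `E` is an equivalence relation on the numbers below `n`. -/
def IsEquivBelow (n : ℕ) (E : ℕ → ℕ → Prop) : Prop :=
  ∀ x < n, E x x ∧ ∀ y < n, (E x y → E y x) ∧ ∀ z < n, E x y → E y z → E x z

theorem IsEquivBelow.of_iff {n : ℕ} {E : ℕ → ℕ → Prop} {a : ℕ → ℕ}
    (h : ∀ x < n, ∀ y < n, (E x y ↔ a x = a y)) : IsEquivBelow n E := by
  refine fun x hx => ⟨(h x hx x hx).2 rfl, fun y hy => ⟨fun hxy => ?_, fun z hz hxy hyz => ?_⟩⟩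
  · exact (h y hy x hx).2 ((h x hx y hy).1 hxy).symm
  · exact (h x hx z hz).2 (((h x hx y hy).1 hxy).trans ((h y hy z hz).1 hyz))

theorem IsEquivBelow.least {n : ℕ} {E : ℕ → ℕ → Prop} {a : ℕ → ℕ} (hE : IsEquivBelow n E)
    (ha : ∀ z < n, LeastFrom (E z) n 0 (a z)) {z : ℕ} (hz : z < n) : a z ≤ z ∧ E z (a z) := by
  have h := (ha z hz).min z (Nat.zero_le _) hz (hE z hz).1
  exact ⟨h, (ha z hz).prop (by omega)⟩

/-- Least elements of classes are canonical representatives. With `IsEquivBelow.of_iff`, comparing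
labels for all pairs is a complete test for being an equivalence relation, without checking triples.
-/
theorem IsEquivBelow.iff_least {n : ℕ} {E : ℕ → ℕ → Prop} {a : ℕ → ℕ} (hE : IsEquivBelow n E)
    (ha : ∀ z < n, LeastFrom (E z) n 0 (a z)) {x y : ℕ} (hx : x < n) (hy : y < n) :
    E x y ↔ a x = a y := by
  obtain ⟨h1, h2⟩ := hE.least ha hx
  obtain ⟨h3, h4⟩ := hE.least ha hy
  constructor
  · intro h
    have h' := ((hE x hx).2 y hy).1 h
    refine le_antisymm ((ha x hx).min _ (Nat.zero_le _) (by omega) ?_)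
      ((ha y hy).min _ (Nat.zero_le _) (by omega) ?_)
    · exact ((hE x hx).2 y hy).2 _ (by omega) h h4
    · exact ((hE y hy).2 x hx).2 _ (by omega) h' h2
  · intro h
    rw [← h] at h4
    exact ((hE x hx).2 _ (by omega)).2 y hy h2 (((hE y hy).2 _ (by omega)).1 h4)

/-! ### Reading the matrices and testing for cluster graphs -/

namespace MatchingProgram

open RamProg RamExpr

/-- The entry of the first adjacency matrix for the registers `3` and `4`. -/
def entry₁ : RamExpr := .load (reg 3 * reg 0 + reg 4)

/-- The entry of the second adjacency matrix for the registers `3` and `4`. -/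
def entry₂ : RamExpr := .load (reg 0 * reg 0 + (reg 3 * reg 0 + reg 4))

/-- Equality or adjacency in the first layer. -/
def rel₁ (n : ℕ) (m : ℕ → ℕ) (z j : ℕ) : Prop := z = j ∨ m (z * n + j) ≠ 0

/-- Equality or adjacency in the second layer. -/
def rel₂ (n : ℕ) (m : ℕ → ℕ) (z j : ℕ) : Prop := z = j ∨ m (n * n + (z * n + j)) ≠ 0

/-- Compute `rel₁` and `rel₂` in the registers `5` and `6`. -/
def flags : RamProg := block
  [.assign 5 ((const 0).lt ((reg 3).eq (reg 4) + entry₁)),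
   .assign 6 ((const 0).lt ((reg 3).eq (reg 4) + entry₂))]

/-- Account for the vertex before the one in register `4`. -/
def scanStep : RamProg := block
  [.assign 4 (reg 4 - const 1),
   flags,
   .assign 7 (reg 7 - reg 5 * (reg 7 - reg 4)),
   .assign 8 (reg 8 - reg 6 * (reg 8 - reg 4)),
   .assign 9 (reg 9 + reg 5 * reg 6),
   .assign 10 (reg 10 + reg 5),
   .assign 11 (reg 11 - (reg 3).lt (reg 4) * reg 5 * (reg 11 - reg 4))]

/-- Compute the data of the vertex in register `3`. -/
def scanVertex : RamProg := .seq (block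
  [.assign 4 (reg 0), .assign 7 (reg 0), .assign 8 (reg 0), .assign 9 (const 0),
   .assign 10 (const 0), .assign 11 (reg 0)])
  (.seq (.loop (reg 4) scanStep) (block
  [setArr 0 (reg 3) (reg 7), setArr 1 (reg 3) (reg 8), setArr 2 (reg 3) (reg 9),
   setArr 3 (reg 3) (reg 11), setArr 4 (reg 3) ((reg 7).eq (reg 3) * reg 10),
   .assign 3 (reg 3 + const 1)]))

/-- Compute the data of all vertices. -/
def prepare : RamProg := .seq
  (block [.assign 2 (const 2 * (reg 0 * reg 0)), .assign 3 (const 0)])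
  (.loop ((reg 3).lt (reg 0)) scanVertex)

/-- Test whether a pair of vertices is consistent with the data. -/
def checkStep : RamProg := block
  [flags,
   .assign 12 (reg 12 * ((reg 5).eq ((arr 0 (reg 3)).eq (arr 0 (reg 4))) *
     (reg 6).eq ((arr 1 (reg 3)).eq (arr 1 (reg 4))))),
   .assign 4 (reg 4 + const 1)]

/-- Test whether both layers are cluster graphs. -/
def check : RamProg := .seq (block [.assign 12 (const 1), .assign 3 (const 0)])
  (.loop ((reg 3).lt (reg 0)) (.seq (.assign 4 (const 0))
    (.seq (.loop ((reg 4).lt (reg 0)) checkStep) (.assign 3 (reg 3 + const 1)))))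

/-- The whole program. -/
def solve : RamProg := .seq prepare (.seq check (.ite (reg 12)
  (.seq (.assign 13 (const 0)) (.seq mainLoop answer)) (.assign 0 (const 0))))

variable {n d W : ℕ} {m : ℕ → ℕ} {s : RamState}

/-- The input is in place. -/
structure InputState (n d : ℕ) (m : ℕ → ℕ) (s : RamState) : Prop where
  size : s.reg 0 = n
  budget : s.reg 1 = d
  base : s.reg 2 = 2 * (n * n)
  mem : ∀ p < 2 * (n * n), s.mem p = m p
  c5 : s.col 5 = fun _ => 0
  c6 : s.col 6 = fun _ => 0
  c7 : s.col 7 = fun _ => 0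

theorem InputState.set (h : InputState n d m s) {i : ℕ} (x : ℕ)
    (h0 : 0 ≠ i) (h1 : 1 ≠ i) (h2 : 2 ≠ i) : InputState n d m (s.set i x) := by
  obtain ⟨_, _, _, _, _, _, _⟩ := h
  constructor <;> simp [*]
  assumption

theorem InputState.setCol (h : InputState n d m s) {k : ℕ} (i x : ℕ) (hk : k < 5) :
    InputState n d m (s.setCol k i x) := by
  obtain ⟨_, _, hb, hmem, h5, h6, h7⟩ := h
  constructor
  case size | budget | base => simpa
  case mem =>
    intro p hp
    rw [RamState.setCol_mem_of_lt _ _ _ _ (by omega)]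
    exact hmem p hp
  all_goals rw [RamState.col_setCol_of_ne _ _ _ (by omega) (by omega) (by omega)]; assumption

theorem InputState.congr {s' : RamState} (h : InputState n d m s) (h0 : s'.reg 0 = s.reg 0)
    (h1 : s'.reg 1 = s.reg 1) (h2 : s'.reg 2 = s.reg 2) (hm : s'.mem = s.mem) :
    InputState n d m s' := by
  obtain ⟨_, _, _, hmem, h5, h6, h7⟩ := h
  have hc : s'.col = s.col := by funext k i; simp [RamState.col, hm, h2]
  exact ⟨by omega, by omega, by omega, by rwa [hm], by rwa [hc], by rwa [hc], by rwa [hc]⟩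

theorem address_lt {z j : ℕ} (hz : z < n) (hj : j < n) : z * n + j < n * n := by
  nlinarith

theorem rel₁_iff (h : InputState n d m s) {z j : ℕ} (hz : z < n) (hj : j < n) :
    0 < flag (z = j) + s.mem (z * n + j) ↔ rel₁ n m z j := by
  have := address_lt hz hj
  rw [h.mem _ (by omega), Nat.pos_iff_ne_zero, rel₁]
  simp only [ne_eq, Nat.add_eq_zero_iff, flag_eq_zero, not_and_or, not_not]

theorem rel₂_iff (h : InputState n d m s) {z j : ℕ} (hz : z < n) (hj : j < n) :
    0 < flag (z = j) + s.mem (n * n + (z * n + j)) ↔ rel₂ n m z j := by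
  have := address_lt hz hj
  rw [h.mem _ (by omega), Nat.pos_iff_ne_zero, rel₂]
  simp only [ne_eq, Nat.add_eq_zero_iff, flag_eq_zero, not_and_or, not_not]

theorem wp_flags (hW : 16 ≤ W) (h : InputState n d m s) (h3 : s.reg 3 < n) (h4 : s.reg 4 < n)
    {Q : RamState → Prop}
    (hQ : Q ((s.set 5 (flag (rel₁ n m (s.reg 3) (s.reg 4)))).set 6
      (flag (rel₂ n m (s.reg 3) (s.reg 4))))) : flags.wp W Q s := by
  simp [flags, block, entry₁, entry₂, h.size, rel₁_iff h h3 h4, rel₂_iff h h3 h4]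
  exact ⟨(flag_le_one _).trans (by omega), (flag_le_one _).trans (by omega), hQ⟩

/-- The state while the vertices are accounted for in descending order. -/
structure ScanState (n : ℕ) (m : ℕ → ℕ) (s₀ s : RamState) : Prop where
  mem : s.mem = s₀.mem
  r0 : s.reg 0 = s₀.reg 0
  r1 : s.reg 1 = s₀.reg 1
  r2 : s.reg 2 = s₀.reg 2
  r3 : s.reg 3 = s₀.reg 3
  le : s.reg 4 ≤ n
  r7 : LeastFrom (rel₁ n m (s₀.reg 3)) n (s.reg 4) (s.reg 7)
  r8 : LeastFrom (rel₂ n m (s₀.reg 3)) n (s.reg 4) (s.reg 8)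
  r9 : s.reg 9 = countFrom (fun j => rel₁ n m (s₀.reg 3) j ∧ rel₂ n m (s₀.reg 3) j) n (s.reg 4)
  r10 : s.reg 10 = countFrom (rel₁ n m (s₀.reg 3)) n (s.reg 4)
  r11 : LeastFrom (fun j => s₀.reg 3 < j ∧ rel₁ n m (s₀.reg 3) j) n (s.reg 4) (s.reg 11)

/-- All data of a vertex are updated from the same two flags in one descending pass, which keeps the
preparation quadratic. The specification does not assume that the layers are cluster graphs; this is
tested afterwards. -/
theorem run_scanStep (hW : 16 ≤ W) (hWn : n + 2 ≤ W) (hs : s.Bdd W) {s₀ : RamState}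
    (hi : InputState n d m s₀) (h3 : s₀.reg 3 < n) (h : ScanState n m s₀ s) (h4 : s.reg 4 ≠ 0) :
    scanStep.Run W s 80 fun s' => ScanState n m s₀ s' ∧ s'.reg 4 < s.reg 4 := by
  obtain ⟨j, hj⟩ := Nat.exists_eq_succ_of_ne_zero h4
  obtain ⟨hm, h0, h1, h2, e3, hle, h7, h8, h9, h10, h11⟩ := h
  have hi' := hi.congr h0 h1 h2 hm
  rw [hj] at h7 h8 h9 h10 h11
  have hjn : j < n := by omega
  refine Run.of_wp_forall hW hs (by decide) (by decide) fun P hP => ?_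
  rw [scanStep, block, wp_seq, wp_assign]
  simp only [eval_sub, eval_reg, eval_const, hj, Nat.succ_sub_one, Nat.succ_eq_add_one]
  refine ⟨by omega, ?_⟩
  rw [block, wp_seq]
  refine wp_flags hW (hi'.set _ (by decide) (by decide) (by decide)) (by simp; omega)
    (by simpa using hjn) ?_
  simp [block, e3, h9, h10, flag_mul_flag]
  set z := s₀.reg 3
  have b7 := h7.pred.le
  have b8 := h8.pred.le
  have b11 := h11.pred.le
  have b9 := countFrom_le (fun j => rel₁ n m z j ∧ rel₂ n m z j) n j
  have b10 := countFrom_le (rel₁ n m z) n j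
  rw [countFrom_pred hjn] at b9 b10
  refine ⟨by omega, by omega, by omega, by omega, by omega,
    hP _ ⟨⟨by simpa using hm, by simpa using h0, by simpa using h1, by simpa using h2,
    by simpa using e3, by simp; omega, ?_, ?_, ?_, ?_, ?_⟩, ?_⟩⟩
  · simpa using h7.pred
  · simpa using h8.pred
  · simp [countFrom_pred hjn]; rfl
  · simp [countFrom_pred hjn]; rfl
  · simpa using h11.pred
  · simp [hj]

/-- The data of a vertex. -/
structure VertexSpec (n : ℕ) (m : ℕ → ℕ) (z a b w nx u : ℕ) : Prop where
  least_a : LeastFrom (rel₁ n m z) n 0 a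
  least_b : LeastFrom (rel₂ n m z) n 0 b
  w_eq : w = countFrom (fun j => rel₁ n m z j ∧ rel₂ n m z j) n 0
  least_nx : LeastFrom (fun j => z < j ∧ rel₁ n m z j) n 0 nx
  u_eq : u = flag (a = z) * countFrom (rel₁ n m z) n 0

/-- The data of the vertices below `k` have been computed. -/
def Prepared (n d : ℕ) (m : ℕ → ℕ) (k : ℕ) (s : RamState) : Prop :=
  InputState n d m s ∧ ∀ z < k, VertexSpec n m z (s.col 0 z) (s.col 1 z) (s.col 2 z) (s.col 3 z)
    (s.col 4 z)

theorem run_scanVertex (hW : 16 ≤ W) (hWn : n + 2 ≤ W) (hs : s.Bdd W)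
    (h : Prepared n d m (s.reg 3) s) (h3 : s.reg 3 < n) :
    scanVertex.Run W s (200 * (n + 1)) fun s' => Prepared n d m (s'.reg 3) s' ∧
      s'.reg 3 = s.reg 3 + 1 := by
  obtain ⟨hi, hspec⟩ := h
  refine (Run.seq (T₁ := 12) (T₂ := n * 82 + 2 + 100) (P := fun s' => ScanState n m s s' ∧ s'.reg 4 = n)
    ?_ ?_).mono (by omega) fun _ _ => id
  · refine Run.of_wp_forall hW hs (by decide) (by decide) fun P hP => ?_
    simp [block, hi.size]
    refine ⟨by omega, hP _ ⟨⟨?_, ?_, ?_, ?_, ?_, ?_, ?_, ?_, ?_, ?_, ?_⟩, ?_⟩⟩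
    all_goals simp [LeastFrom.self, countFrom_self, hi.size]
  rintro s₁ hs₁ ⟨hS₁, h4⟩
  refine Run.seq (T₁ := n * 82 + 2) (T₂ := 100) ((Run.loop (e := reg 4) hW (by decide)
    (ScanState n m s) (fun s' => s'.reg 4) 80
    (fun s' hs' hI he => run_scanStep hW hWn hs' hi h3 hI he) hs₁ hS₁).mono ?_ fun _ _ => id) ?_
  · change s₁.reg 4 * 82 + 2 ≤ _
    rw [h4]
  rintro s₂ hs₂ ⟨⟨hm, h0, h1, h2, e3, hle, h7, h8, h9, h10, h11⟩, he⟩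
  rw [eval_reg] at he
  rw [he] at h7 h8 h9 h10 h11
  have hi' := hi.congr h0 h1 h2 hm
  have b7 := h7.le
  have b8 := h8.le
  have b11 := h11.le
  have b9 := countFrom_le (fun j => rel₁ n m (s.reg 3) j ∧ rel₂ n m (s.reg 3) j) n 0
  have b10 := countFrom_le (rel₁ n m (s.reg 3)) n 0
  have bf : flag (s₂.reg 7 = s.reg 3) * countFrom (rel₁ n m (s.reg 3)) n 0 ≤ n :=
    (Nat.mul_le_mul (flag_le_one _) b10).trans (by omega)
  have hc : s₂.col = s.col := by funext k i; simp [RamState.col, hm, h2]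
  refine Run.of_wp_forall hW hs₂ (by decide) (by decide) fun P hP => ?_
  simp [block, e3, h9, h10]
  refine ⟨by omega, by omega, by omega, by omega, by omega, by omega, hP _ ⟨⟨?_, ?_⟩, ?_⟩⟩
  · exact (((((hi'.setCol _ _ (by decide)).setCol _ _ (by decide)).setCol _ _ (by decide)).setCol
      _ _ (by decide)).setCol _ _ (by decide)).set _ (by decide) (by decide) (by decide)
  · intro z hz
    simp at hz
    by_cases e : z = s.reg 3
    · subst e
      simp
      exact ⟨h7, h8, rfl, h11, rfl⟩
    · simpa [e, hc] using hspec z (by omega)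
  · simp

theorem run_prepare (hW : 16 ≤ W) (hWn : n + 2 ≤ W) (hW2 : 2 * (n * n) ≤ W) (hs : s.Bdd W)
    (h0 : s.reg 0 = n) (h1 : s.reg 1 = d) (hmem : ∀ p, 2 * (n * n) ≤ p → s.mem p = 0) :
    prepare.Run W s (300 * (n + 1) ^ 2) fun s' => Prepared n d s.mem n s' := by
  refine (Run.seq (T₁ := 8) (T₂ := n * (4 + 200 * (n + 1)) + 4) (P := fun s' =>
    InputState n d s.mem s' ∧ s'.reg 3 = 0) ?_ ?_).mono (by nlinarith) fun _ _ => id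
  · refine Run.of_wp_forall hW hs (by decide) (by decide) fun P hP => ?_
    simp [block, h0]
    refine ⟨hW2, hP _ ⟨⟨?_, ?_, ?_, ?_, ?_, ?_, ?_⟩, ?_⟩⟩
    case refine_5 | refine_6 | refine_7 =>
      funext i
      simp only [RamState.col, RamState.set_mem]
      exact hmem _ (by simp)
    all_goals simp [h0, h1]
  rintro s₁ hs₁ ⟨hi, h3⟩
  refine (Run.loop hW (by decide) (fun s' => s'.reg 3 ≤ n ∧ Prepared n d s.mem (s'.reg 3) s')
    (fun s' => n - s'.reg 3) (200 * (n + 1)) ?_ hs₁ ⟨by omega, hi, by omega⟩).mono ?_ ?_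
  · rintro s₂ hs₂ ⟨hle, hp⟩ he
    simp [hp.1.size] at he
    exact (run_scanVertex hW hWn hs₂ hp he).mono le_rfl fun s' _ h =>
      ⟨⟨by omega, h.1⟩, by omega⟩
  · change (n - s₁.reg 3) * (4 + 200 * (n + 1)) + 4 ≤ _
    rw [h3]; rfl
  · rintro s' - ⟨⟨hle, hp⟩, he⟩
    simp [hp.1.size] at he
    obtain e : s'.reg 3 = n := by omega
    rwa [e] at hp

/-- A pair of vertices is consistent with `a` and `b`. -/
def PairOk (n : ℕ) (m : ℕ → ℕ) (a b : ℕ → ℕ) (z j : ℕ) : Prop :=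
  (rel₁ n m z j ↔ a z = a j) ∧ (rel₂ n m z j ↔ b z = b j)

/-- The state during the test. -/
structure CheckState (n d : ℕ) (m : ℕ → ℕ) (s₀ s : RamState) (p : Prop) : Prop where
  input : InputState n d m s
  col : s.col = s₀.col
  ok : s.reg 12 = flag p

theorem CheckState.set {s₀ : RamState} {p : Prop} (h : CheckState n d m s₀ s p) {i : ℕ} (x : ℕ)
    (h0 : 0 ≠ i) (h1 : 1 ≠ i) (h2 : 2 ≠ i) (h12 : 12 ≠ i) : CheckState n d m s₀ (s.set i x) p :=
  ⟨h.input.set _ h0 h1 h2, by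
    rw [← h.col]; funext k; simp [h2], by rw [RamState.set_reg_of_ne _ _ h12]; exact h.ok⟩

theorem forall_lt_succ_iff {p : ℕ → Prop} {k : ℕ} :
    (∀ j < k + 1, p j) ↔ (∀ j < k, p j) ∧ p k :=
  ⟨fun h => ⟨fun j hj => h j (by omega), h k (by omega)⟩, fun h j hj =>
    (Nat.lt_succ_iff_lt_or_eq.1 hj).elim (h.1 j) fun e => e ▸ h.2⟩

theorem run_check (hW : 16 ≤ W) (hWn : n + 2 ≤ W) (hs : s.Bdd W) (hi : InputState n d m s) :
    check.Run W s (300 * (n + 1) ^ 2) fun s' =>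
      CheckState n d m s s' (∀ z < n, ∀ j < n, PairOk n m (s.col 0) (s.col 1) z j) := by
  set ok := PairOk n m (s.col 0) (s.col 1) with hok
  refine (Run.seq (T₁ := 4) (T₂ := n * (4 + (2 + (n * 104 + 4 + 4))) + 4) (P := fun s' =>
    CheckState n d m s s' True ∧ s'.reg 3 = 0) ?_ ?_).mono (by nlinarith) fun _ _ => id
  · refine Run.of_wp_forall hW hs (by decide) (by decide) fun P hP => ?_
    simp [block]
    refine ⟨by omega, hP _ ⟨⟨(hi.set _ (by decide) (by decide) (by decide)).set _ (by decide)
      (by decide) (by decide), ?_, ?_⟩, by simp⟩⟩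
    · funext k; simp
    · simp [flag_of_true]
  rintro s₁ hs₁ ⟨hC₁, h3⟩
  refine (Run.loop hW (by decide) (fun s' => s'.reg 3 ≤ n ∧
    CheckState n d m s s' (∀ z < s'.reg 3, ∀ j < n, ok z j))
    (fun s' => n - s'.reg 3) (2 + (n * 104 + 4 + 4)) ?_ hs₁
    ⟨by omega, by simpa [h3] using hC₁⟩).mono ?_ ?_
  · rintro s₂ hs₂ ⟨hle, hC₂⟩ he
    simp [hC₂.input.size] at he
    refine Run.seq (P := fun s' => (CheckState n d m s s' (∀ z < s₂.reg 3, ∀ j < n, ok z j) ∧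
      s'.reg 3 = s₂.reg 3) ∧ s'.reg 4 = 0) ?_ ?_
    · refine Run.of_wp_forall hW hs₂ (by decide) (by decide) fun P hP => ?_
      simp
      exact hP _ ⟨⟨hC₂.set _ (by decide) (by decide) (by decide) (by decide), by simp⟩, by simp⟩
    rintro s₃ hs₃ ⟨⟨hC₃, e3⟩, h4⟩
    refine Run.seq (P := fun s' => CheckState n d m s s' ((∀ z < s₂.reg 3, ∀ j < n, ok z j) ∧
      ∀ j < n, ok (s₂.reg 3) j) ∧ s'.reg 3 = s₂.reg 3) ?_ ?_
    · refine (Run.loop hW (by decide) (fun s' => s'.reg 4 ≤ n ∧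
        CheckState n d m s s' ((∀ z < s₂.reg 3, ∀ j < n, ok z j) ∧
        ∀ j < s'.reg 4, ok (s₂.reg 3) j) ∧ s'.reg 3 = s₂.reg 3)
        (fun s' => n - s'.reg 4) 100 ?_ hs₃ ⟨by omega, by simpa [h4] using hC₃, e3⟩).mono ?_ ?_
      · rintro s₄ hs₄ ⟨hle₄, ⟨hi₄, hcol, hreg⟩, e3⟩ he₄
        simp [hi₄.size] at he₄
        refine Run.of_wp_forall hW hs₄ (by decide) (by decide) fun P hP => ?_
        rw [checkStep, block, wp_seq]
        refine wp_flags hW hi₄ (by omega) he₄ ?_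
        simp [block, hreg, flag_mul_flag, flag_inj, hcol, e3]
        refine ⟨(flag_le_one _).trans (by omega), by omega, hP _ ⟨⟨?_, ⟨?_, ?_, ?_⟩, ?_⟩, ?_⟩⟩
        · simp; omega
        · exact (((hi₄.set _ (by decide) (by decide) (by decide)).set _ (by decide) (by decide)
            (by decide)).set _ (by decide) (by decide) (by decide)).set _ (by decide) (by decide)
            (by decide)
        · rw [← hcol]; funext k; simp
        · have := forall_lt_succ_iff (p := ok (s₂.reg 3)) (k := s₄.reg 4)
          rw [RamState.set_reg_of_ne _ _ (by decide), RamState.set_reg_self, RamState.set_reg_self,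
            this]
          simp only [and_assoc]
          rfl
        · simpa using e3
        · simp; omega
      · change (n - s₃.reg 4) * 104 + 4 ≤ _
        rw [h4]; rfl
      · rintro s' - ⟨⟨hle, hC, e3⟩, he⟩
        simp [hC.input.size] at he
        obtain e : s'.reg 4 = n := by omega
        rw [e] at hC
        exact ⟨hC, e3⟩
    · rintro s₄ hs₄ ⟨hC₄, e3⟩
      refine Run.of_wp_forall hW hs₄ (by decide) (by decide) fun P hP => ?_
      simp [e3]
      refine ⟨by omega, hP _ ⟨⟨by simp; omega, ?_⟩, by simp; omega⟩⟩
      simp only [RamState.set_reg_self, forall_lt_succ_iff]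
      exact hC₄.set _ (by decide) (by decide) (by decide) (by decide)
  · change (n - s₁.reg 3) * (4 + (2 + (n * 104 + 4 + 4))) + 4 ≤ _
    rw [h3]; rfl
  · rintro s' - ⟨⟨hle, hC⟩, he⟩
    simp [hC.input.size] at he
    obtain e : s'.reg 3 = n := by omega
    rwa [e] at hC

end MatchingProgram

/-! ### Initial potentials and correctness of the whole program -/

namespace MatchingProgram

open RamProg RamExpr

variable {n d W : ℕ} {m : ℕ → ℕ} {s : RamState}

theorem overlapData {a b w nx u : ℕ → ℕ}
    (h : ∀ z < n, VertexSpec n m z (a z) (b z) (w z) (nx z) (u z))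
    (hok : ∀ z < n, ∀ j < n, PairOk n m a b z j) : OverlapData n a b w nx := by
  have h1 : IsEquivBelow n (rel₁ n m) := .of_iff fun z hz j hj => (hok z hz j hj).1
  have h2 : IsEquivBelow n (rel₂ n m) := .of_iff fun z hz j hj => (hok z hz j hj).2
  have ha {z : ℕ} (hz : z < n) := h1.least (fun z hz => (h z hz).least_a) hz
  have hb {z : ℕ} (hz : z < n) := h2.least (fun z hz => (h z hz).least_b) hz
  refine ⟨fun z hz => (ha hz).1, fun z hz => ?_, fun z hz => (hb hz).1.trans_lt hz,
    fun z hz => ?_, fun z hz => ?_, fun z hz => (h z hz).least_nx.le, fun z hz hlt => ?_,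
    fun z hz j hj hlt e => ?_⟩
  · exact ((hok z hz _ ((ha hz).1.trans_lt hz)).1.1 (ha hz).2).symm
  · classical
    rw [(h z hz).w_eq, countFrom_zero]
    refine congrArg _ (Finset.filter_congr fun j hj => ?_)
    have := hok z hz j (Finset.mem_range.1 hj)
    rw [this.1, this.2, eq_comm, eq_comm (a := b z)]
  · rcases (h z hz).least_nx.le.lt_or_eq with hlt | e
    · exact ((h z hz).least_nx.prop hlt).1
    · omega
  · exact ((hok z hz _ hlt).1.1 ((h z hz).least_nx.prop hlt).2).symm
  · exact (h z hz).least_nx.min j (Nat.zero_le _) hj ⟨hlt, (hok z hz j hj).1.2 e.symm⟩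

open Finset in
theorem size_eq {a b w nx u : ℕ → ℕ}
    (h : ∀ z < n, VertexSpec n m z (a z) (b z) (w z) (nx z) (u z))
    (hok : ∀ z < n, ∀ j < n, PairOk n m a b z j) {z : ℕ} (hz : z < n) :
    u z = if a z = z then #{j ∈ range n | a j = z} else 0 := by
  classical
  rw [(h z hz).u_eq, countFrom_zero, flag_eq_ite]
  split_ifs with hzz
  · rw [one_mul]
    refine congrArg _ (Finset.filter_congr fun j hj => ?_)
    have := (hok z hz j (Finset.mem_range.1 hj)).1
    rw [this, hzz, eq_comm]
  · simp

-- Each vertex is counted once, in its own part. This bounds the initial sum of `u`, and with it the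
-- number of rounds.
open Finset in
theorem sum_size_le {a b w nx u : ℕ → ℕ}
    (h : ∀ z < n, VertexSpec n m z (a z) (b z) (w z) (nx z) (u z))
    (hok : ∀ z < n, ∀ j < n, PairOk n m a b z j) : ∑ j ∈ range n, u j ≤ n := by
  calc ∑ j ∈ range n, u j ≤ ∑ z ∈ range n, #{j ∈ range n | a j = z} := by
        refine sum_le_sum fun z hz => ?_
        rw [size_eq h hok (mem_range.1 hz)]
        split_ifs <;> simp
    _ = #(range n) := by
        refine (card_eq_sum_card_fiberwise fun z hz => ?_).symm
        simp only [coe_range, Set.mem_Iio] at hz ⊢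
        exact (overlapData h hok).a_lt hz
    _ = n := card_range n

/-- The cluster sizes cover the weights since `|X ∩ Y| ≤ |X|`; the rest is vacuous for the empty
matching and zero right potentials. -/
theorem primalDual_init {a b w nx u : ℕ → ℕ}
    (h : ∀ z < n, VertexSpec n m z (a z) (b z) (w z) (nx z) (u z))
    (hok : ∀ z < n, ∀ j < n, PairOk n m a b z j) :
    PrimalDual n a b w u (fun _ => 0) (fun _ => 0) (fun _ => 0) 0 n := by
  have hd := overlapData h hok
  refine ⟨fun z hz => ?_, fun _ _ _ h => ?_, fun _ _ _ _ h => ?_, fun _ h => ?_, fun _ _ h => ?_⟩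
  · rw [size_eq h hok (hd.a_lt hz), if_pos (hd.a_idem z hz), hd.w_eq z hz]
    exact Finset.card_le_card (Finset.monotone_filter_right _ fun _ _ h => h.1)
  · simp at h
  · simp at h
  · omega
  · exact absurd rfl h

open Finset in
/-- The instance `(n, d, m)` is a yes-instance. -/
def IsYes (n d : ℕ) (m : ℕ → ℕ) : Prop :=
  IsEquivBelow n (rel₁ n m) ∧ IsEquivBelow n (rel₂ n m) ∧
    ∃ K ⊆ range n, (∀ z ∈ K, ∀ z' ∈ K, rel₁ n m z z' ↔ rel₂ n m z z') ∧ n ≤ #K + d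

theorem run_solve (hW : 16 ≤ W) (hWn : n + 2 ≤ W) (hW2 : 2 * (n * n) ≤ W) (hs : s.Bdd W)
    (h0 : s.reg 0 = n) (h1 : s.reg 1 = d) (hmem : ∀ p, 2 * (n * n) ≤ p → s.mem p = 0) :
    solve.Run W s (3000 * (n + 1) ^ 2) fun s' =>
      (IsYes n d s.mem → s'.reg 0 = 1) ∧ (¬ IsYes n d s.mem → s'.reg 0 = 0) := by
  have hpow : n + 1 ≤ (n + 1) ^ 2 := Nat.le_self_pow two_ne_zero _
  refine (Run.seq (T₂ := 300 * (n + 1) ^ 2 + (2 + (2 + (1600 * (n + 1) ^ 2 + 100 * (n + 1)))))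
    (run_prepare hW hWn hW2 hs h0 h1 hmem) ?_).mono (by omega) fun _ _ => id
  rintro s₁ hs₁ ⟨hi, hspec⟩
  refine Run.seq (run_check hW hWn hs₁ hi) ?_
  rintro s₂ hs₂ ⟨hi₂, hcol, hreg⟩
  refine Run.ite (T := 2 + (1600 * (n + 1) ^ 2 + 100 * (n + 1))) hW hs₂ (by decide) ?_ ?_
  · intro he
    simp [hreg] at he
    have hd := overlapData hspec he
    refine Run.seq (P := fun s' => MainInv n d (s₁.col 0) (s₁.col 1) (s₁.col 2) (s₁.col 3) s' ∧
      s'.reg 13 = 0 ∧ s'.col 4 = s₁.col 4) ?_ ?_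
    · refine Run.of_wp_forall hW hs₂ (by decide) (by decide) fun P hP => ?_
      simp
      refine hP _ ⟨⟨s₁.col 4, fun _ => 0, fun _ => 0, fun _ => 0, 0, Nat.zero_le _, ?_,
        primalDual_init hspec he, fun x hx hax => ?_⟩, by simp, by simp [hcol]⟩
      · constructor
        case size => simpa using hi₂.size
        case budget => simpa using hi₂.budget
        case c5 => simpa using hi₂.c5
        case c6 => simpa using hi₂.c6
        case c7 => simpa using hi₂.c7
        all_goals simp [hcol]
      · rw [size_eq hspec he hx, if_neg hax]
    rintro s₃ hs₃ ⟨hI, h13, h4⟩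
    refine Run.seq (run_mainLoop hW hWn hd hs₃ hI (by rw [h4]; exact sum_size_le hspec he) h13) ?_
    rintro s₄ hs₄ ⟨u, v, ml, mr, hm, hp⟩
    obtain ⟨K, hK, hab, hcard⟩ := hp.exists_le_card hd
    have hKn : K.card ≤ n := by simpa using Finset.card_le_card hK
    -- Weak duality bounds every competing `K'` by the sum of the potentials, and the set `K` from
    -- the matching attains it.
    have hyes : IsYes n d s.mem ↔ n ≤ ∑ j ∈ Finset.range n, (u j + v j) + d := by
      constructor
      · rintro ⟨-, -, K', hK', hab', hn⟩
        have := hp.card_le hd hK' fun z hz z' hz' => by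
          have h1 := Finset.mem_range.1 (hK' hz)
          have h2 := Finset.mem_range.1 (hK' hz')
          rw [← (he z h1 z' h2).1, ← (he z h1 z' h2).2]
          exact hab' z hz z' hz'
        omega
      · intro hn
        refine ⟨.of_iff fun z hz j hj => (he z hz j hj).1, .of_iff fun z hz j hj => (he z hz j hj).2,
          K, hK, fun z hz z' hz' => ?_, by omega⟩
        have h1 := Finset.mem_range.1 (hK hz)
        have h2 := Finset.mem_range.1 (hK hz')
        rw [(he z h1 z' h2).1, (he z h1 z' h2).2]
        exact hab z hz z' hz'
    rw [hyes]
    exact run_answer hW hWn hs₄ hm (hcard.trans hKn)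
  · intro he
    simp [hreg] at he
    obtain ⟨z, hz, j, hj, hne⟩ := he
    -- A pair on which the labels disagree with a relation shows that this layer is not a cluster
    -- graph.
    have hno : ¬ IsYes n d s.mem := by
      rintro ⟨h1, h2, -⟩
      exact hne ⟨h1.iff_least (fun z hz => (hspec z hz).least_a) hz hj,
        h2.iff_least (fun z hz => (hspec z hz).least_b) hz hj⟩
    refine Run.of_wp_forall hW hs₂ (by decide) (show 2 ≤ _ by omega) fun P hP => ?_
    simp
    exact hP _ ⟨fun h => absurd h hno, fun _ => by simp⟩

end MatchingProgram

/-! ## Cluster graphs and sets on which two layers agree -/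

section Graphs

variable {V : Type*}

theorem isClusterGraph_iff {G : SimpleGraph V} :
    IsClusterGraph G ↔ ∀ x y z, G.Adj x y → G.Adj y z → x = z ∨ G.Adj x z := by
  constructor
  · intro h x y z hxy hyz
    by_cases hxz : x = z
    · exact Or.inl hxz
    · exact Or.inr (h (G.connectedComponentMk y)
        (SimpleGraph.ConnectedComponent.sound hxy.reachable)
        (SimpleGraph.ConnectedComponent.sound hyz.symm.reachable) hxz)
  · intro h c x hx y hy hxy
    have hr : G.Reachable x y := SimpleGraph.ConnectedComponent.exact (hx.trans hy.symm)
    obtain ⟨p⟩ := hr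
    -- Transitivity contracts a walk to a single edge or a point.
    have key : ∀ {x y : V} (_ : G.Walk x y), x = y ∨ G.Adj x y := by
      intro x y p
      induction p with
      | nil => exact Or.inl rfl
      | cons e _ ih =>
        rcases ih with rfl | ih
        · exact Or.inr e
        · exact h _ _ _ e ih
    exact (key p).resolve_left hxy

theorem editGraph_empty (G : SimpleGraph V) : editGraph G ∅ = G := by
  simp [editGraph, ← Set.bot_eq_empty]

/-- Outside of some `d` vertices, the two graphs agree. -/
def AgreeUpTo [Fintype V] (G₁ G₂ : SimpleGraph V) (d : ℕ) : Prop :=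
  ∃ K : Finset V, (∀ x ∈ K, ∀ y ∈ K, G₁.Adj x y ↔ G₂.Adj x y) ∧ Fintype.card V ≤ K.card + d

theorem induce_eq_induce_iff {G₁ G₂ : SimpleGraph V} {S : Set V} :
    G₁.induce S = G₂.induce S ↔ ∀ x ∈ S, ∀ y ∈ S, G₁.Adj x y ↔ G₂.Adj x y := by
  constructor
  · intro h x hx y hy
    have := congrArg (fun H : SimpleGraph S => H.Adj ⟨x, hx⟩ ⟨y, hy⟩) h
    simpa using this
  · intro h
    ext x y
    simpa using h x x.2 y y.2

theorem agreeUpTo_iff [Fintype V] {G₁ G₂ : SimpleGraph V} {d : ℕ} :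
    AgreeUpTo G₁ G₂ d ↔ ∃ D : Finset V, D.card ≤ d ∧
      G₁.induce ((D : Set V)ᶜ) = G₂.induce ((D : Set V)ᶜ) := by
  classical
  simp only [induce_eq_induce_iff]
  constructor
  · rintro ⟨K, h, hK⟩
    refine ⟨Kᶜ, ?_, fun x hx y hy => h x (by simpa using hx) y (by simpa using hy)⟩
    rw [Finset.card_compl]; omega
  · rintro ⟨D, hD, h⟩
    refine ⟨Dᶜ, fun x hx y hy => h x (by simpa using hx) y (by simpa using hy), ?_⟩
    rw [Finset.card_compl]; omega

theorem isBounded_zero {l : ℕ} {M : Fin l → Finset (Sym2 V)} (h : IsBounded 0 M) :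
    M = fun _ => ∅ := by
  funext i
  exact Finset.card_eq_zero.1 (Nat.le_zero.1 (h i))

theorem isClustering_empty (G : Fin 2 → SimpleGraph V) :
    IsClustering G (fun _ => ∅) ↔ IsClusterGraph (G 0) ∧ IsClusterGraph (G 1) := by
  simp [IsClustering, IsClusterEditingSet, editGraph_empty, Fin.forall_fin_two]

theorem tce_iff [Fintype V] (G : Fin 2 → SimpleGraph V) (d : ℕ) :
    TCE G 0 d ↔ IsClusterGraph (G 0) ∧ IsClusterGraph (G 1) ∧ AgreeUpTo (G 0) (G 1) d := by
  rw [agreeUpTo_iff, ← and_assoc, ← isClustering_empty]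
  constructor
  · rintro ⟨M, h1, h2, D, h3⟩
    obtain rfl := isBounded_zero h2
    obtain ⟨h4, h5⟩ := h3 0
    rw [editGraph_empty, editGraph_empty] at h5
    exact ⟨h1, D 0, h4, h5⟩
  · rintro ⟨h1, D, h2, h3⟩
    refine ⟨_, h1, fun i => by simp, fun _ => D, fun i => ⟨h2, ?_⟩⟩
    obtain ⟨i, hi⟩ := i
    obtain rfl : i = 0 := by omega
    rw [editGraph_empty, editGraph_empty]
    exact h3

theorem mlce_iff [Fintype V] (G : Fin 2 → SimpleGraph V) (d : ℕ) :
    MLCE G 0 d ↔ IsClusterGraph (G 0) ∧ IsClusterGraph (G 1) ∧ AgreeUpTo (G 0) (G 1) d := by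
  rw [agreeUpTo_iff, ← and_assoc, ← isClustering_empty]
  constructor
  · rintro ⟨M, h1, h2, D, h3, h4⟩
    obtain rfl := isBounded_zero h2
    have h5 := h4 0 1
    rw [editGraph_empty, editGraph_empty] at h5
    exact ⟨h1, D, h3, h5⟩
  · rintro ⟨h1, D, h2, h3⟩
    refine ⟨_, h1, fun i => by simp, D, h2, ?_⟩
    simp only [editGraph_empty, Fin.forall_fin_two]
    exact ⟨⟨trivial, h3⟩, h3.symm, trivial⟩

/-! ### Maximal cliques and matchings -/

/-- The maximal clique that contains a given vertex of a cluster graph. -/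
def clusterOf {G : SimpleGraph V} (h : IsClusterGraph G) (x : V) : MaxClique G :=
  ⟨{y | x = y ∨ G.Adj x y}, by
    rw [isClusterGraph_iff] at h
    refine ⟨?_, fun Y hY hle y hy => ?_⟩
    · rintro y (rfl | hy) z (rfl | hz) hyz
      · exact absurd rfl hyz
      · exact hz
      · exact hy.symm
      · exact (h y x z hy.symm hz).resolve_left hyz
    · by_cases e : x = y
      · exact Or.inl e
      · exact Or.inr (hY (hle (Or.inl rfl)) hy e)⟩

theorem mem_clusterOf {G : SimpleGraph V} (h : IsClusterGraph G) (x : V) :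
    x ∈ (clusterOf h x).1 := Or.inl rfl

theorem MaxClique.eq_clusterOf {G : SimpleGraph V} (h : IsClusterGraph G) {X : MaxClique G} {x : V}
    (hx : x ∈ X.1) : X = clusterOf h x := by
  have hle : X.1 ≤ (clusterOf h x).1 := by
    intro y hy
    by_cases e : x = y
    · exact Or.inl e
    · exact Or.inr (X.2.1 hx hy e)
  exact Subtype.ext (le_antisymm hle (X.2.2 (clusterOf h x).2.1 hle))

theorem MaxClique.eq_of_mem {G : SimpleGraph V} (h : IsClusterGraph G) {X Y : MaxClique G} {x : V}
    (hX : x ∈ X.1) (hY : x ∈ Y.1) : X = Y :=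
  (eq_clusterOf h hX).trans (eq_clusterOf h hY).symm

variable {G₁ G₂ : SimpleGraph V}

open Classical in
/-- The vertices in the intersection of the cliques that an edge joins. -/
noncomputable def commonVertices [Fintype V] (e : Sym2 (MaxClique G₁ ⊕ MaxClique G₂)) : Finset V :=
  {z | ∀ p ∈ e, z ∈ cliqueOf p}

theorem interWeight_eq_card [Fintype V] (e : Sym2 (MaxClique G₁ ⊕ MaxClique G₂)) :
    interWeight e = (commonVertices e).card := by
  induction e using Sym2.ind with
  | _ p q =>
    rw [← Set.ncard_coe_finset]
    change (cliqueOf p ∩ cliqueOf q).ncard = _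
    congr 1
    ext z
    simp [commonVertices]

theorem exists_of_mem_edgeSet {M : (interGraph G₁ G₂).Subgraph}
    {e : Sym2 (MaxClique G₁ ⊕ MaxClique G₂)} (he : e ∈ M.edgeSet) :
    ∃ X Y, e = s(.inl X, .inr Y) ∧ M.Adj (.inl X) (.inr Y) := by
  induction e using Sym2.ind with
  | _ p q =>
    have h : M.Adj p q := he
    have h' := M.adj_sub h
    rcases p with X | X <;> rcases q with Y | Y
    · simp at h'
    · exact ⟨X, Y, rfl, h⟩
    · exact ⟨Y, X, Sym2.eq_swap, h.symm⟩
    · simp at h'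

theorem matchingWeight_eq_sum [Fintype V] (M : (interGraph G₁ G₂).Subgraph) :
    matchingWeight M = ∑ e ∈ (Set.toFinite M.edgeSet).toFinset, (commonVertices e).card := by
  rw [matchingWeight, finsum_mem_eq_finite_toFinset_sum _ (Set.toFinite _)]
  exact Finset.sum_congr rfl fun e _ => interWeight_eq_card e

/-- Take the union of the intersections along the matching. Two of its vertices in a common cluster
on one side lie on the same matching edge, hence in a common cluster on the other. The intersections
are disjoint because a vertex determines both of its clusters, so their sizes add up to the weight.
-/
theorem exists_agree_of_isMatching [Fintype V] (h₁ : IsClusterGraph G₁) (h₂ : IsClusterGraph G₂)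
    {M : (interGraph G₁ G₂).Subgraph} (hM : M.IsMatching) :
    ∃ K : Finset V, (∀ x ∈ K, ∀ y ∈ K, G₁.Adj x y ↔ G₂.Adj x y) ∧ K.card = matchingWeight M := by
  classical
  have uniq {v w w' : MaxClique G₁ ⊕ MaxClique G₂} (h : M.Adj v w) (h' : M.Adj v w') : w = w' :=
    (hM (M.edge_vert h)).unique h h'
  refine ⟨(Set.toFinite M.edgeSet).toFinset.biUnion commonVertices, ?_, ?_⟩
  · have mem {x : V} (hx : x ∈ (Set.toFinite M.edgeSet).toFinset.biUnion commonVertices) :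
        ∃ X Y, M.Adj (.inl X) (.inr Y) ∧ x ∈ X.1 ∧ x ∈ Y.1 := by
      simp only [Finset.mem_biUnion, Set.Finite.mem_toFinset] at hx
      obtain ⟨e, he, hx⟩ := hx
      obtain ⟨X, Y, rfl, hXY⟩ := exists_of_mem_edgeSet he
      exact ⟨X, Y, hXY, by simpa [commonVertices, cliqueOf] using hx⟩
    intro x hx y hy
    obtain ⟨X, Y, hXY, hxX, hxY⟩ := mem hx
    obtain ⟨X', Y', hXY', hyX, hyY⟩ := mem hy
    constructor
    · intro h
      have hyX' : y ∈ X.1 := by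
        rw [MaxClique.eq_clusterOf h₁ hxX]; exact Or.inr h
      obtain rfl := MaxClique.eq_of_mem h₁ hyX hyX'
      obtain rfl := Sum.inr_injective (uniq hXY hXY')
      exact Y.2.1 hxY hyY h.ne
    · intro h
      have hyY' : y ∈ Y.1 := by
        rw [MaxClique.eq_clusterOf h₂ hxY]; exact Or.inr h
      obtain rfl := MaxClique.eq_of_mem h₂ hyY hyY'
      obtain rfl := Sum.inl_injective (uniq hXY.symm hXY'.symm)
      exact X.2.1 hxX hyX h.ne
  · rw [matchingWeight_eq_sum, Finset.card_biUnion]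
    intro e he e' he' hne
    rw [Set.Finite.coe_toFinset] at he he'
    obtain ⟨X, Y, rfl, hXY⟩ := exists_of_mem_edgeSet he
    obtain ⟨X', Y', rfl, hXY'⟩ := exists_of_mem_edgeSet he'
    rw [Function.onFun, Finset.disjoint_left]
    intro z hz hz'
    have h1 : z ∈ X.1 ∧ z ∈ Y.1 := by simpa [commonVertices, cliqueOf] using hz
    have h2 : z ∈ X'.1 ∧ z ∈ Y'.1 := by simpa [commonVertices, cliqueOf] using hz'
    obtain rfl := MaxClique.eq_of_mem h₁ h1.1 h2.1
    obtain rfl := MaxClique.eq_of_mem h₂ h1.2 h2.2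
    exact hne rfl

/-- The edges of the intersection graph that have a common vertex in `K`. -/
def agreeSubgraph (G₁ G₂ : SimpleGraph V) (K : Finset V) : (interGraph G₁ G₂).Subgraph where
  verts := {p | ∃ q, (interGraph G₁ G₂).Adj p q ∧ ∃ z ∈ K, z ∈ cliqueOf p ∧ z ∈ cliqueOf q}
  Adj p q := (interGraph G₁ G₂).Adj p q ∧ ∃ z ∈ K, z ∈ cliqueOf p ∧ z ∈ cliqueOf q
  adj_sub h := h.1
  edge_vert h := ⟨_, h⟩
  symm := ⟨fun _ _ ⟨h, z, hz, h1, h2⟩ => ⟨h.symm, z, hz, h2, h1⟩⟩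

/-- Two edges at a common cluster yield two vertices of `K` that are equal or adjacent in one layer,
hence in the other, so the opposite clusters coincide. -/
theorem agreeSubgraph_isMatching (h₁ : IsClusterGraph G₁) (h₂ : IsClusterGraph G₂) {K : Finset V}
    (hK : ∀ x ∈ K, ∀ y ∈ K, G₁.Adj x y ↔ G₂.Adj x y) :
    (agreeSubgraph G₁ G₂ K).IsMatching := by
  rintro p ⟨q, hpq, z, hz, hzp, hzq⟩
  refine ⟨q, ⟨hpq, z, hz, hzp, hzq⟩, ?_⟩
  rintro q' ⟨hpq', z', hz', hzp', hzq'⟩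
  rcases p with X | Y <;> rcases q with X' | Y' <;> rcases q' with X'' | Y'' <;>
    simp at hpq hpq' <;> simp only [cliqueOf, Sum.elim_inl, Sum.elim_inr] at hzp hzq hzp' hzq'
  · have : z' ∈ Y'.1 := by
      rw [MaxClique.eq_clusterOf h₂ hzq]
      by_cases e : z = z'
      · exact Or.inl e
      · exact Or.inr ((hK z hz z' hz').1 (X.2.1 hzp hzp' e))
    rw [MaxClique.eq_of_mem h₂ hzq' this]
  · have : z' ∈ X'.1 := by
      rw [MaxClique.eq_clusterOf h₁ hzq]
      by_cases e : z = z'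
      · exact Or.inl e
      · exact Or.inr ((hK z hz z' hz').2 (Y.2.1 hzp hzp' e))
    rw [MaxClique.eq_of_mem h₁ hzq' this]

/-- Each vertex of `K` lies on the edge between its own two clusters. Equality may fail, as the
weights also count vertices outside `K`. -/
theorem card_le_matchingWeight_agreeSubgraph [Fintype V] (h₁ : IsClusterGraph G₁)
    (h₂ : IsClusterGraph G₂) (K : Finset V) :
    K.card ≤ matchingWeight (agreeSubgraph G₁ G₂ K) := by
  classical
  rw [matchingWeight_eq_sum]
  refine (Finset.card_le_card fun z hz => ?_).trans Finset.card_biUnion_le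
  simp only [Finset.mem_biUnion, Set.Finite.mem_toFinset]
  refine ⟨s(.inl (clusterOf h₁ z), .inr (clusterOf h₂ z)), ⟨by simp, z, hz, mem_clusterOf h₁ z,
    mem_clusterOf h₂ z⟩, ?_⟩
  simp [commonVertices, cliqueOf, mem_clusterOf]

theorem agreeUpTo_iff_exists_isMatching [Fintype V] (h₁ : IsClusterGraph G₁)
    (h₂ : IsClusterGraph G₂) (d : ℕ) : AgreeUpTo G₁ G₂ d ↔
      ∃ M : (interGraph G₁ G₂).Subgraph, M.IsMatching ∧
        (Fintype.card V : ℤ) - d ≤ matchingWeight M := by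
  constructor
  · rintro ⟨K, hK, hd⟩
    refine ⟨_, agreeSubgraph_isMatching h₁ h₂ hK, ?_⟩
    have := card_le_matchingWeight_agreeSubgraph h₁ h₂ K
    omega
  · rintro ⟨M, hM, hd⟩
    obtain ⟨K, hK, hc⟩ := exists_agree_of_isMatching h₁ h₂ hM
    exact ⟨K, hK, by omega⟩

end Graphs

/-! ## The input of the program -/

namespace MatchingProgram

variable {n d : ℕ}

theorem ramInput_mem_ne_zero (G : Fin 2 → SimpleGraph (Fin n)) (i : Fin 2) (u v : Fin n) :
    (ramInput G d).mem ((i : ℕ) * (n * n) + ((u : ℕ) * n + (v : ℕ))) ≠ 0 ↔ (G i).Adj u v := by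
  have hlt (u v : Fin n) := address_lt u.2 v.2
  have hmod (u v : Fin n) : ((u : ℕ) * n + v) / n = u ∧ ((u : ℕ) * n + v) % n = v := by
    have hn : 0 < n := u.pos
    rw [mul_comm, Nat.mul_add_div hn, Nat.mul_add_mod]
    simp [Nat.div_eq_of_lt v.2, Nat.mod_eq_of_lt v.2]
  simp only [ramInput, ne_eq, ite_eq_right_iff, one_ne_zero, imp_false, not_not]
  constructor
  · rintro ⟨i', u', v', h, hadj⟩
    have h1 := hlt u v
    have h2 := hlt u' v'
    -- Each matrix occupies a block of length `n * n`, so the block determines the layer; quotient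
    -- and remainder modulo `n` then determine row and column.
    have hi : i = i' := by
      fin_cases i <;> fin_cases i' <;> simp at h ⊢ <;> omega
    subst hi
    have e : (u : ℕ) * n + v = (u' : ℕ) * n + v' := by omega
    have hu : u = u' := Fin.ext (by rw [← (hmod u v).1, e, (hmod u' v').1])
    have hv : v = v' := Fin.ext (by rw [← (hmod u v).2, e, (hmod u' v').2])
    rwa [hu, hv]
  · exact fun h => ⟨i, u, v, by ring, h⟩

theorem ramInput_mem_eq_zero (G : Fin 2 → SimpleGraph (Fin n)) {p : ℕ} (hp : 2 * (n * n) ≤ p) :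
    (ramInput G d).mem p = 0 := by
  simp only [ramInput, ite_eq_right_iff, one_ne_zero, imp_false]
  rintro ⟨i, u, v, h, -⟩
  have := address_lt u.2 v.2
  have hi : (i : ℕ) * (n * n) ≤ 1 * (n * n) := Nat.mul_le_mul_right _ (by omega)
  omega

theorem rel₁_ramInput (G : Fin 2 → SimpleGraph (Fin n)) (u v : Fin n) :
    rel₁ n (ramInput G d).mem u v ↔ u = v ∨ (G 0).Adj u v := by
  have := ramInput_mem_ne_zero (d := d) G 0 u v
  rw [rel₁, ← this, Fin.ext_iff]
  simp

theorem rel₂_ramInput (G : Fin 2 → SimpleGraph (Fin n)) (u v : Fin n) :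
    rel₂ n (ramInput G d).mem u v ↔ u = v ∨ (G 1).Adj u v := by
  have := ramInput_mem_ne_zero (d := d) G 1 u v
  rw [rel₂, ← this, Fin.ext_iff]
  simp

theorem isEquivBelow_iff_isClusterGraph {G : SimpleGraph (Fin n)} {E : ℕ → ℕ → Prop}
    (hE : ∀ u v : Fin n, E u v ↔ u = v ∨ G.Adj u v) : IsEquivBelow n E ↔ IsClusterGraph G := by
  rw [isClusterGraph_iff]
  constructor
  · intro h x y z hxy hyz
    rw [← hE]
    exact ((h x x.2).2 y y.2).2 z z.2 ((hE x y).2 (Or.inr hxy)) ((hE y z).2 (Or.inr hyz))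
  · intro h x hx
    lift x to Fin n using hx
    refine ⟨(hE x x).2 (Or.inl rfl), fun y hy => ?_⟩
    lift y to Fin n using hy
    refine ⟨fun hxy => ?_, fun z hz hxy hyz => ?_⟩
    · rw [hE] at hxy ⊢
      exact hxy.imp Eq.symm fun h => h.symm
    · lift z to Fin n using hz
      rw [hE] at hxy hyz ⊢
      rcases hxy with rfl | hxy
      · exact hyz
      · rcases hyz with rfl | hyz
        · exact Or.inr hxy
        · exact h x y z hxy hyz

theorem isYes_ramInput (G : Fin 2 → SimpleGraph (Fin n)) : IsYes n d (ramInput G d).mem ↔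
    IsClusterGraph (G 0) ∧ IsClusterGraph (G 1) ∧ AgreeUpTo (G 0) (G 1) d := by
  have h1 := rel₁_ramInput (d := d) G
  have h2 := rel₂_ramInput (d := d) G
  rw [IsYes, isEquivBelow_iff_isClusterGraph h1, isEquivBelow_iff_isClusterGraph h2]
  refine and_congr_right fun _ => and_congr_right fun _ => ?_
  constructor
  · rintro ⟨K, hK, h, hn⟩
    have hlt : ∀ z ∈ K, z < n := fun z hz => Finset.mem_range.1 (hK hz)
    refine ⟨K.attachFin hlt, fun x hx y hy => ?_, by simpa using hn⟩
    rw [Finset.mem_attachFin] at hx hy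
    have := h x hx y hy
    rw [h1, h2] at this
    by_cases e : x = y
    · subst e; simp
    · simpa [e] using this
  · rintro ⟨K, h, hn⟩
    refine ⟨K.map Fin.valEmbedding, fun z hz => ?_, fun z hz z' hz' => ?_, by simpa using hn⟩
    · obtain ⟨x, -, rfl⟩ := Finset.mem_map.1 hz
      exact Finset.mem_range.2 x.2
    · obtain ⟨x, hx, rfl⟩ := Finset.mem_map.1 hz
      obtain ⟨y, hy, rfl⟩ := Finset.mem_map.1 hz'
      simp only [Fin.valEmbedding_apply]
      rw [h1, h2, h x hx y hy]

end MatchingProgram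

/-! ### The asymptotic time bound and the conclusion -/

theorem isBigO_sq_mul_log (C : ℕ) :
    (fun n : ℕ => ((C * (n + 1) ^ 2 : ℕ) : ℝ)) =O[atTop] fun n : ℕ => (n : ℝ) ^ 2 * Real.log n := by
  refine IsBigO.of_bound (C * 4) ?_
  -- From `3 > e` on the logarithm is at least `1`, so a quadratic running time suffices.
  filter_upwards [eventually_ge_atTop 3] with n hn
  have hn' : (3 : ℝ) ≤ n := by exact_mod_cast hn
  have hlog : 1 ≤ Real.log n := by
    rw [Real.le_log_iff_exp_le (by linarith)]
    exact (Real.exp_one_lt_d9.le.trans (by norm_num)).trans hn'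
  rw [Real.norm_of_nonneg (by positivity), Real.norm_of_nonneg (by positivity)]
  push_cast
  have h1 : ((n : ℝ) + 1) ^ 2 ≤ 4 * (n : ℝ) ^ 2 := by nlinarith
  have h2 : (n : ℝ) ^ 2 ≤ (n : ℝ) ^ 2 * Real.log n := le_mul_of_one_le_right (by positivity) hlog
  calc (C : ℝ) * ((n : ℝ) + 1) ^ 2 ≤ C * (4 * ((n : ℝ) ^ 2 * Real.log n)) := by
        refine mul_le_mul_of_nonneg_left (by linarith) (by positivity)
    _ = _ := by ring

theorem solvableInTime_of_iff {L : ∀ {n : ℕ}, (Fin 2 → SimpleGraph (Fin n)) → ℕ → Prop}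
    (hL : ∀ {n : ℕ} (G : Fin 2 → SimpleGraph (Fin n)) (d : ℕ), L G d ↔
      IsClusterGraph (G 0) ∧ IsClusterGraph (G 1) ∧ AgreeUpTo (G 0) (G 1) d) :
    SolvableInTime L fun n => (n : ℝ) ^ 2 * Real.log n := by
  -- Stored numbers are bounded by `W = (n + d + 2) ^ 4`, which exceeds `16`, the input numbers and
  -- the base address `2 * (n * n)`. Intermediate results are at most `W ^ 64`, whence `256 = 4 *
  -- 64`.
  refine ⟨MatchingProgram.solve, 256, fun n => 3000 * (n + 1) ^ 2, isBigO_sq_mul_log 3000,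
    fun n G d => ?_⟩
  have h2 : 2 ≤ n + d + 2 := by omega
  have hsq : (n + d + 2) ^ 4 = (n + d + 2) * (n + d + 2) * ((n + d + 2) * (n + d + 2)) := by ring
  have h4 : 4 ≤ (n + d + 2) * (n + d + 2) := Nat.mul_le_mul h2 h2
  have hW : 16 ≤ (n + d + 2) ^ 4 := by rw [hsq]; exact Nat.mul_le_mul h4 h4
  have hself : n + d + 2 ≤ (n + d + 2) ^ 4 := Nat.le_self_pow (by norm_num) _
  have hW2 : 2 * (n * n) ≤ (n + d + 2) ^ 4 := by
    rw [hsq]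
    refine Nat.mul_le_mul (by omega) (Nat.mul_le_mul ?_ ?_) <;> omega
  have hs : (ramInput G d).Bdd ((n + d + 2) ^ 4) := by
    refine ⟨fun r => ?_, fun p => ?_⟩
    · simp only [ramInput]
      split_ifs <;> omega
    · simp only [ramInput]
      split_ifs <;> omega
  obtain ⟨t, s', h, ht, -, hyes, hno⟩ := MatchingProgram.run_solve (d := d) hW (by omega) hW2 hs
    (by simp [ramInput]) (by simp [ramInput])
    (fun p hp => MatchingProgram.ramInput_mem_eq_zero (d := d) G hp)
  rw [← pow_mul] at h
  rw [MatchingProgram.isYes_ramInput, ← hL] at hyes hno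
  exact ⟨t, s', h, ht, hyes, hno⟩

theorem proposition1 :
    SolvableInTime (fun G d => TCE G 0 d) (fun n => (n : ℝ) ^ 2 * Real.log n) ∧
    SolvableInTime (fun G d => MLCE G 0 d) (fun n => (n : ℝ) ^ 2 * Real.log n) ∧
    ∀ (V : Type*) [Fintype V] (G : Fin 2 → SimpleGraph V) (d : ℕ),
      (TCE G 0 d ↔ IsClusterGraph (G 0) ∧ IsClusterGraph (G 1) ∧
        ∃ M : (interGraph (G 0) (G 1)).Subgraph, M.IsMatching ∧
          (Fintype.card V : ℤ) - d ≤ matchingWeight M) ∧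
      (MLCE G 0 d ↔ IsClusterGraph (G 0) ∧ IsClusterGraph (G 1) ∧
        ∃ M : (interGraph (G 0) (G 1)).Subgraph, M.IsMatching ∧
          (Fintype.card V : ℤ) - d ≤ matchingWeight M) := by
  refine ⟨solvableInTime_of_iff tce_iff, solvableInTime_of_iff mlce_iff, fun V _ G d => ?_⟩
  rw [tce_iff, mlce_iff, and_self]
  exact and_congr_right fun h₁ => and_congr_right fun h₂ =>
    agreeUpTo_iff_exists_isMatching h₁ h₂ d
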